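/- Let $m\ge 0$ and $n\ge 1$ be integers. An environment is a function $E:\{0,\dots,m-1\}\times\mathbb{Z}_n\to\{0,1\}$, and we write $E_t(i)=E(t,i)$. For a rule $\rho:\{0,1\}^3\to\{0,1\}$, $E$ evolves according to $\rho$ if $E_t(i)=\rho(E_{t-1}(i-1),E_{t-1}(i),E_{t-1}(i+1))$ for all $0<t<m$ and $i\in\mathbb{Z}_n$ (operations on locations are modulo $n$). $E$ is $\varepsilon$-far from evolving according to $\rho$ if $|\{(t,i):E(t,i)\ne E'(t,i)\}|>\varepsilon mn$ for every environment $E'$ (with the same $m,n$) that evolves according to $\rho$. A rule $\rho$ is a threshold rule if there are an integer $0\le b\le 3$ and a bit $\alpha\in\{0,1\}$ such that $\rho(\beta_1,\beta_2,\beta_3)=\alpha$ if and only if $\beta_1+\beta_2+\beta_3\ge b$. **Theorem.** For every threshold rule $\rho$ there are a constant $C$ and a randomized algorithm that, given $m$, $n$, a distance parameter $\varepsilon\in(0,1)$ and query access to an environment $E:\{0,\dots,m-1\}\times\mathbb{Z}_n\to\{0,1\}$, always makes at most $C/\varepsilon^4$ queries to $E$ and satisfies the following. If $E$ evolves according to $\rho$,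 the algorithm accepts with probability $1$ (one-sided error). If $E$ is $\varepsilon$-far from evolving according to $\rho$, it rejects with probability at least $2/3$. Moreover, the algorithm is non-adaptive: its queries depend only on $m,n,\varepsilon$ and its coin tosses, and not on the answers to earlier queries; in particular they can be, and are, made in order of non-decreasing time $t$. -/

import Mathlib

/-- A local evolution rule `ρ : {0,1}³ → {0,1}`. -/
abbrev LocalRule : Type := Bool → Bool → Bool → Bool

/-- `ρ` is a threshold rule: for some integer `0 ≤ b ≤ 3` and some bit `α`,
`ρ(β₁,β₂,β₃) = α` if and only if `β₁ + β₂ + β₃ ≥ b`. -/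
def IsThresholdRule (ρ : LocalRule) : Prop :=
  ∃ b : ℕ, b ≤ 3 ∧ ∃ α : Bool, ∀ β₁ β₂ β₃ : Bool,
    ρ β₁ β₂ β₃ = α ↔ b ≤ β₁.toNat + β₂.toNat + β₃.toNat

/-- An environment with time steps `0, …, m - 1` and locations in the integers modulo `n`;
`E t i` is the value of location `i` at time `t`. -/
abbrev Environment (m n : ℕ) : Type := Fin m → ZMod n → Bool

/-- The environment `E` evolves according to `ρ`: each value at a positive time is `ρ` applied to
the values at the previous time of the location and its two neighbours (cyclically). -/
def Environment.EvolvesAccordingTo {m n : ℕ} (E : Environment m n) (ρ : LocalRule) : Prop :=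
  ∀ (t : ℕ) (ht : t + 1 < m) (i : ZMod n),
    E ⟨t + 1, ht⟩ i =
      ρ (E ⟨t, Nat.lt_of_succ_lt ht⟩ (i - 1)) (E ⟨t, Nat.lt_of_succ_lt ht⟩ i)
        (E ⟨t, Nat.lt_of_succ_lt ht⟩ (i + 1))

/-- The number of time-location pairs on which two environments differ. -/
def Environment.numDiff {m n : ℕ} [NeZero n] (E E' : Environment m n) : ℕ :=
  (Finset.univ.filter fun p : Fin m × ZMod n => E p.1 p.2 ≠ E' p.1 p.2).card

/-- The environment `E` is `ε`-far from evolving according to `ρ`. -/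
def Environment.IsFarFromEvolving {m n : ℕ} [NeZero n] (E : Environment m n) (ρ : LocalRule)
    (ε : ℝ) : Prop :=
  ∀ E' : Environment m n, E'.EvolvesAccordingTo ρ → ε * m * n < (E.numDiff E' : ℝ)

/-- A deterministic non-adaptive query algorithm for `m × n` environments: a list of queries,
which is fixed before any answer is seen and never goes back in time, and a decision
(`true` = accept) that is a function of the list of answers only. -/
structure NonadaptiveAlgorithm (m n : ℕ) where
  /-- the queried time-location pairs, in the order in which they are made -/
  queries : List (Fin m × ZMod n)
  /-- no query follows a query at a later time -/
  timeConforming : queries.Pairwise fun p q => p.1 ≤ q.1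
  /-- the verdict, given the answers to the queries -/
  decision : List Bool → Bool

/-- The verdict (`true` = accept) of the algorithm when it is run on the environment `E`. -/
def NonadaptiveAlgorithm.run {m n : ℕ} (A : NonadaptiveAlgorithm m n) (E : Environment m n) :
    Bool :=
  A.decision (A.queries.map fun p => E p.1 p.2)

/-- A randomized non-adaptive algorithm: a probability distribution on deterministic ones (the
outcome of the coin tosses determines the queries and the decision function). -/
abbrev RandomizedNonadaptiveAlgorithm (m n : ℕ) : Type := PMF (NonadaptiveAlgorithm m n)

namespace RandomizedNonadaptiveAlgorithm

/-- The probability that the algorithm gives the verdict `v` on the environment `E`. -/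
noncomputable def probVerdict {m n : ℕ} (T : RandomizedNonadaptiveAlgorithm m n)
    (E : Environment m n) (v : Bool) : ENNReal :=
  PMF.map (fun A : NonadaptiveAlgorithm m n => A.run E) T v

/-- `T` is a one-sided error tester, with distance parameter `ε`, for evolution according to `ρ`:
it accepts with probability `1` every environment that evolves according to `ρ`, and rejects with
probability at least `2/3` every environment that is `ε`-far from doing so. -/
def IsOneSidedTester {m n : ℕ} [NeZero n] (T : RandomizedNonadaptiveAlgorithm m n)
    (ρ : LocalRule) (ε : ℝ) : Prop :=
  (∀ E : Environment m n, E.EvolvesAccordingTo ρ → probVerdict T E true = 1) ∧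
  (∀ E : Environment m n, E.IsFarFromEvolving ρ ε → 2 / 3 ≤ probVerdict T E false)

/-- Every possible run of `T` makes at most `q` queries. -/
def QueryComplexityLE {m n : ℕ} (T : RandomizedNonadaptiveAlgorithm m n) (q : ℝ) : Prop :=
  ∀ A ∈ PMF.support T, (A.queries.length : ℝ) ≤ q

end RandomizedNonadaptiveAlgorithm

/-! Testing reduces to prediction. Suppose each point `p` has a small query set `Q p`, and each
environment `E` a single configuration `g`, such that for all but an `ε / 2` fraction of points `p`,
every evolving environment agreeing with `E` on `Q p` takes at `p` the value of the evolution of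
`g`. That evolution differs from an `ε`-far `E` in more than an `ε` fraction of points, so at least
an `ε / 2` fraction of points `p` are inconsistent with `E` on `Q p` together with `p`. Sampling
about `4 / ε` points finds one with probability at least `2/3`; consistency with evolution is always
accepted.

Complementing values, possibly depending on the time, reduces threshold rules to a constant, NOR, OR
and majority. NOR has period two from time 1 on (`step_norRule_step_step`). OR and majority use
`IsPredictable.of_grid`: values at the two times `Δ` and `Δ + 2 * s`, near grid points about `s`
apart and near the column of `p`, suffice.

For OR, `g` is the largest configuration allowed by the grid values at time `Δ`; its evolution is
correct except around the time at which a column turns to 1.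

For majority, call a location unstable if it differs from both neighbours. Stable locations are
frozen, unstable ones flip, and stability spreads one location per step, so a location ends with the
value of the nearest stable one. At time `Δ`, unstable locations at distance at most `2 * Δ` have
only unstable ones between them; so the grid reveals the alternating stretches, up to `2 * s` at
their ends, and the remaining gaps are frozen `2 * s` steps later. Gluing these data gives `g`. The
prediction can fail only early, around the time at which stability arrives, near grid points, or
near the middle of a stretch, where the nearer end is uncertain. Such middles are rare because
stretches are about `Δ` apart. -/

/-- One step of the evolution of a configuration according to a local rule. -/
def LocalRule.step (ρ : LocalRule) {R : Type*} [Ring R] (f : R → Bool) : R → Bool :=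
  fun i => ρ (f (i - 1)) (f i) (f (i + 1))

theorem Environment.evolvesAccordingTo_of_eq_iterate {m n : ℕ} {ρ : LocalRule}
    {E : Environment m n} (f : ZMod n → Bool)
    (h : ∀ t i, E t i = ρ.step^[(t : ℕ)] f i) : E.EvolvesAccordingTo ρ := by
  intro t ht i
  simp only [h, Function.iterate_succ_apply', LocalRule.step]

theorem Environment.EvolvesAccordingTo.exists_eq_iterate {m n : ℕ} {ρ : LocalRule}
    {E : Environment m n} (hE : E.EvolvesAccordingTo ρ) :
    ∃ f : ZMod n → Bool, ∀ t i, E t i = ρ.step^[(t : ℕ)] f i := by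
  rcases Nat.eq_zero_or_pos m with rfl | hm
  · exact ⟨fun _ => false, fun t => t.elim0⟩
  · refine ⟨E ⟨0, hm⟩, ?_⟩
    rintro ⟨t, ht⟩
    induction t with
    | zero => intro i; rfl
    | succ t ih =>
      intro i
      rw [hE t ht i]
      simp only [Function.iterate_succ_apply', LocalRule.step]
      rw [ih, ih, ih]

/-! ### Testing reduced to prediction -/

/-- The answers to the queries `Q p` predict the value at `p` of an evolving environment,
consistently with a single initial configuration `g`, for all but few points `p`. -/
def Predicts (ρ : LocalRule) {m n : ℕ} (ε : ℝ)
    (Q : Fin m × ZMod n → Finset (Fin m × ZMod n)) : Prop :=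
  ∀ E : Environment m n, ∃ (g : ZMod n → Bool) (X : Finset (Fin m × ZMod n)),
    (X.card : ℝ) ≤ ε / 2 * m * n ∧
    ∀ p ∉ X, ∀ f : ZMod n → Bool,
      (∀ q ∈ Q p, ρ.step^[(q.1 : ℕ)] f q.2 = E q.1 q.2) →
        ρ.step^[(p.1 : ℕ)] f p.2 = ρ.step^[(p.1 : ℕ)] g p.2

/-- Values of environments evolving according to `ρ` can be predicted by `O(1 / ε ^ 3)` queries. -/
def IsPredictable (ρ : LocalRule) : Prop :=
  ∃ C : ℝ, ∀ (m n : ℕ) [NeZero n] (ε : ℝ), 0 < ε → ε < 1 →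
    ∃ Q : Fin m × ZMod n → Finset (Fin m × ZMod n),
      (∀ p, ((Q p).card : ℝ) ≤ C / ε ^ 3) ∧
      Predicts ρ ε Q

/-- The algorithm that queries a finite set of points in order of time and accepts if and only if
the answers are consistent with evolution according to `ρ`. -/
noncomputable def consistencyAlgorithm {m n : ℕ} (ρ : LocalRule)
    (S : Finset (Fin m × ZMod n)) : NonadaptiveAlgorithm m n where
  queries := S.toList.insertionSort fun p q => p.1 ≤ q.1
  timeConforming :=
    haveI : Std.Total fun p q : Fin m × ZMod n => p.1 ≤ q.1 := ⟨fun p q => le_total p.1 q.1⟩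
    haveI : IsTrans (Fin m × ZMod n) fun p q => p.1 ≤ q.1 := ⟨fun _ _ _ h h' => le_trans h h'⟩
    List.pairwise_insertionSort _ _
  decision := fun l => by
    classical
    exact decide (∃ F : Environment m n, F.EvolvesAccordingTo ρ ∧
      (S.toList.insertionSort fun p q => p.1 ≤ q.1).map (fun p => F p.1 p.2) = l)

theorem length_queries_consistencyAlgorithm {m n : ℕ} (ρ : LocalRule)
    (S : Finset (Fin m × ZMod n)) : (consistencyAlgorithm ρ S).queries.length = S.card := by
  simp [consistencyAlgorithm]

theorem run_consistencyAlgorithm {m n : ℕ} (ρ : LocalRule) (S : Finset (Fin m × ZMod n))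
    (E : Environment m n) : (consistencyAlgorithm ρ S).run E = true ↔
      ∃ F : Environment m n, F.EvolvesAccordingTo ρ ∧ ∀ p ∈ S, F p.1 p.2 = E p.1 p.2 := by
  simp [consistencyAlgorithm, NonadaptiveAlgorithm.run, List.map_inj_left]

theorem probVerdict_map_uniformOfFintype {m n : ℕ} {Ω : Type} [Fintype Ω] [Nonempty Ω]
    (A : Ω → NonadaptiveAlgorithm m n) (E : Environment m n) (v : Bool) :
    RandomizedNonadaptiveAlgorithm.probVerdict ((PMF.uniformOfFintype Ω).map A) E v =
      ((Finset.univ.filter fun ω => (A ω).run E = v).card : ENNReal) / Fintype.card Ω := by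
  classical
  unfold RandomizedNonadaptiveAlgorithm.probVerdict
  rw [PMF.map_comp, ← PMF.toOuterMeasure_apply_singleton, PMF.toOuterMeasure_map_apply,
    PMF.toOuterMeasure_uniformOfFintype_apply, ← Fintype.card_subtype]
  congr 2
  exact Fintype.card_congr (Equiv.refl _)

theorem one_sub_half_pow_le {ε : ℝ} (hε : 0 < ε) (hε' : ε < 1) {k : ℕ} (hk : 4 / ε ≤ k) :
    (1 - ε / 2) ^ k ≤ 1 / 3 := by
  have h1 : 1 - ε / 2 ≤ Real.exp (-(ε / 2)) := by
    have := Real.add_one_le_exp (-(ε / 2)); linarith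
  have h2 : (1 - ε / 2) ^ k ≤ Real.exp (-(ε / 2)) ^ k := pow_le_pow_left₀ (by linarith) h1 k
  rw [← Real.exp_nat_mul] at h2
  have h3 : (k : ℝ) * (-(ε / 2)) ≤ -2 := by
    rw [div_le_iff₀ hε] at hk; nlinarith
  have h4 : Real.exp (-2) ≤ 1 / 3 := by
    have : (3 : ℝ) ≤ Real.exp 2 := by
      have := Real.add_one_le_exp 2; linarith
    rw [Real.exp_neg, inv_eq_one_div]
    exact one_div_le_one_div_of_le (by norm_num) this
  exact h2.trans ((Real.exp_le_exp.2 h3).trans h4)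

theorem IsPredictable.exists_tester_of_pos {ρ : LocalRule} {C : ℝ} {m n : ℕ} [NeZero n]
    (hm : 0 < m) {ε : ℝ} (hε : 0 < ε) (hε' : ε < 1)
    {Q : Fin m × ZMod n → Finset (Fin m × ZMod n)}
    (hQ : ∀ p, ((Q p).card : ℝ) ≤ C / ε ^ 3)
    (hQ' : Predicts ρ ε Q) :
    ∃ T : RandomizedNonadaptiveAlgorithm m n, T.IsOneSidedTester ρ ε ∧
      T.QueryComplexityLE (5 * (C + 1) / ε ^ 4) := by
  classical
  obtain ⟨k, hk, hk'⟩ : ∃ k : ℕ, 4 / ε ≤ k ∧ (k : ℝ) ≤ 5 / ε := by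
    refine ⟨⌈4 / ε⌉₊, Nat.le_ceil _, (Nat.ceil_lt_add_one (by positivity)).le.trans ?_⟩
    have : 1 ≤ 1 / ε := by rw [le_div_iff₀ hε]; linarith
    have h5 : 5 / ε = 4 / ε + 1 / ε := by ring
    linarith
  have : Nonempty (Fin m × ZMod n) := ⟨(⟨0, hm⟩, 0)⟩
  let S : (Fin k → Fin m × ZMod n) → Finset (Fin m × ZMod n) :=
    fun ω => Finset.univ.biUnion fun j => insert (ω j) (Q (ω j))
  refine ⟨(PMF.uniformOfFintype (Fin k → Fin m × ZMod n)).map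
    fun ω => consistencyAlgorithm ρ (S ω), ⟨?_, ?_⟩, ?_⟩
  · intro E hE
    rw [probVerdict_map_uniformOfFintype, Finset.filter_true_of_mem, Finset.card_univ]
    · exact ENNReal.div_self (Nat.cast_ne_zero.2 Fintype.card_ne_zero) (ENNReal.natCast_ne_top _)
    · intro ω _
      exact (run_consistencyAlgorithm _ _ _).2 ⟨E, hE, fun _ _ => rfl⟩
  · intro E hfar
    obtain ⟨g, X, hX, hg⟩ := hQ' E
    let good : Finset (Fin m × ZMod n) := Finset.univ.filter fun p =>
      ∃ F : Environment m n, F.EvolvesAccordingTo ρ ∧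
        ∀ q ∈ insert p (Q p), F q.1 q.2 = E q.1 q.2
    let G : Environment m n := fun t i => ρ.step^[(t : ℕ)] g i
    have hG : G.EvolvesAccordingTo ρ :=
      Environment.evolvesAccordingTo_of_eq_iterate g fun _ _ => rfl
    -- A sampled point that passes its local check and lies outside `X` carries the predicted value,
    -- so `E` and `G` agree there.
    have hsub : good ⊆ X ∪ Finset.univ.filter fun p : Fin m × ZMod n => ¬ E p.1 p.2 ≠ G p.1 p.2 := by
      intro p hp
      obtain ⟨F, hF, hFE⟩ := (Finset.mem_filter.1 hp).2
      by_cases hpX : p ∈ X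
      · exact Finset.mem_union_left _ hpX
      · refine Finset.mem_union_right _ (Finset.mem_filter.2 ⟨Finset.mem_univ _, ?_⟩)
        obtain ⟨f, hf⟩ := hF.exists_eq_iterate
        have := hg p hpX f fun q hq => by
          rw [← hf]; exact hFE q (Finset.mem_insert_of_mem hq)
        rw [not_not, ← hFE p (Finset.mem_insert_self _ _), hf, this]
    have hcard : (good.card : ℝ) ≤ (1 - ε / 2) * (m * n) := by
      have h1 := (Finset.card_le_card hsub).trans (Finset.card_union_le _ _)
      have h2 := Finset.card_filter_add_card_filter_not
        (s := (Finset.univ : Finset (Fin m × ZMod n))) fun p => E p.1 p.2 ≠ G p.1 p.2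
      have h3 := hfar G hG
      unfold Environment.numDiff at h3
      rw [Finset.card_univ, Fintype.card_prod, Fintype.card_fin, ZMod.card] at h2
      have h1' : (good.card : ℝ) ≤ _ := Nat.cast_le.2 h1
      have h2' := congrArg (Nat.cast : ℕ → ℝ) h2
      push_cast at h1' h2'
      nlinarith
    -- Global consistency implies local consistency at every sample, so acceptance needs all `k`
    -- independent samples to be good.
    have hacc : (Finset.univ.filter fun ω => (consistencyAlgorithm ρ (S ω)).run E = true) ⊆
        Fintype.piFinset fun _ : Fin k => good := by
      intro ω hω
      obtain ⟨F, hF, hFE⟩ := (run_consistencyAlgorithm _ _ _).1 (Finset.mem_filter.1 hω).2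
      refine Fintype.mem_piFinset.2 fun j => Finset.mem_filter.2 ⟨Finset.mem_univ _, F, hF, ?_⟩
      exact fun q hq => hFE q (Finset.mem_biUnion.2 ⟨j, Finset.mem_univ _, hq⟩)
    have hacc' := Finset.card_le_card hacc
    rw [Fintype.card_piFinset, Finset.prod_const, Finset.card_univ, Fintype.card_fin] at hacc'
    have hsum := Finset.card_filter_add_card_filter_not
      (s := (Finset.univ : Finset (Fin k → Fin m × ZMod n)))
      fun ω => (consistencyAlgorithm ρ (S ω)).run E = true
    simp only [Bool.not_eq_true] at hsum
    rw [probVerdict_map_uniformOfFintype]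
    rw [Finset.card_univ] at hsum
    have hΩ : (Fintype.card (Fin k → Fin m × ZMod n) : ℝ) = (m * n : ℝ) ^ k := by
      simp [ZMod.card]
    set a := (Finset.univ.filter fun ω => (consistencyAlgorithm ρ (S ω)).run E = true).card
    set b := (Finset.univ.filter fun ω => (consistencyAlgorithm ρ (S ω)).run E = false).card
    set N := Fintype.card (Fin k → Fin m × ZMod n)
    have hN : 0 < N := Fintype.card_pos
    have ha : (a : ℝ) ≤ 1 / 3 * N := by
      calc (a : ℝ) ≤ (good.card : ℝ) ^ k := by exact_mod_cast hacc'
        _ ≤ ((1 - ε / 2) * (m * n)) ^ k := pow_le_pow_left₀ (by positivity) hcard k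
        _ = (1 - ε / 2) ^ k * N := by rw [mul_pow, hΩ]
        _ ≤ 1 / 3 * N := by
          gcongr
          exact one_sub_half_pow_le hε hε' hk
    have h3 : 2 * N ≤ 3 * b := by
      have : (a : ℝ) + b = N := by exact_mod_cast hsum
      have : (2 * N : ℝ) ≤ 3 * b := by linarith
      exact_mod_cast this
    rw [ENNReal.le_div_iff_mul_le (by simp [hN.ne']) (by simp)]
    rw [mul_comm, ← mul_div_assoc, ENNReal.div_le_iff (by simp) (by simp), mul_comm,
      mul_comm (b : ENNReal)]
    exact_mod_cast h3
  · intro A hA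
    obtain ⟨ω, -, rfl⟩ := (PMF.mem_support_map_iff _ _ _).1 hA
    rw [length_queries_consistencyAlgorithm]
    have h1 : ((S ω).card : ℝ) ≤ ∑ j : Fin k, ((Q (ω j)).card + 1 : ℝ) := by
      have : (S ω).card ≤ ∑ j : Fin k, ((Q (ω j)).card + 1) :=
        Finset.card_biUnion_le.trans (Finset.sum_le_sum fun j _ => Finset.card_insert_le _ _)
      exact_mod_cast this
    have h2 : ∀ j : Fin k, ((Q (ω j)).card + 1 : ℝ) ≤ (C + 1) / ε ^ 3 := by
      intro j
      have : (1 : ℝ) ≤ 1 / ε ^ 3 := by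
        rw [le_div_iff₀ (by positivity), one_mul]
        exact pow_le_one₀ hε.le hε'.le
      rw [add_div]
      exact add_le_add (hQ _) this
    have h0 : 0 ≤ (C + 1) / ε ^ 3 := by
      have := h2 ⟨0, by
        have : (0 : ℝ) < k := lt_of_lt_of_le (by positivity) hk
        exact_mod_cast this⟩
      exact le_trans (by positivity) this
    calc ((S ω).card : ℝ) ≤ ∑ j : Fin k, ((Q (ω j)).card + 1 : ℝ) := h1
      _ ≤ ∑ _j : Fin k, (C + 1) / ε ^ 3 := Finset.sum_le_sum fun j _ => h2 j
      _ = k * ((C + 1) / ε ^ 3) := by simp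
      _ ≤ 5 / ε * ((C + 1) / ε ^ 3) := by gcongr
      _ = 5 * (C + 1) / ε ^ 4 := by field_simp

theorem IsPredictable.exists_tester {ρ : LocalRule} (h : IsPredictable ρ) :
    ∃ (C : ℝ) (T : (m n : ℕ) → (ε : ℝ) → RandomizedNonadaptiveAlgorithm m n),
      ∀ (m n : ℕ) [NeZero n] (ε : ℝ), 0 < ε → ε < 1 →
        RandomizedNonadaptiveAlgorithm.IsOneSidedTester (T m n ε) ρ ε ∧
        RandomizedNonadaptiveAlgorithm.QueryComplexityLE (T m n ε) (C / ε ^ 4) := by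
  obtain ⟨C, hC⟩ := h
  have key : ∀ (m n : ℕ) (ε : ℝ), ∃ T : RandomizedNonadaptiveAlgorithm m n,
      ∀ [NeZero n], 0 < ε → ε < 1 → T.IsOneSidedTester ρ ε ∧
        -- The maximum keeps the bound nonnegative when `m = 0`, where the bound on `Q` gives no
        -- information about `C`.
        T.QueryComplexityLE (max 0 (5 * (C + 1)) / ε ^ 4) := by
    intro m n ε
    let A : NonadaptiveAlgorithm m n := ⟨[], List.Pairwise.nil, fun _ => true⟩
    by_cases h : NeZero n ∧ 0 < ε ∧ ε < 1
    · obtain ⟨hn, hε, hε'⟩ := h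
      rcases Nat.eq_zero_or_pos m with rfl | hm
      · refine ⟨PMF.pure A, fun _ _ => ⟨⟨fun E _ => ?_, fun E hE => ?_⟩, ?_⟩⟩
        · simp [RandomizedNonadaptiveAlgorithm.probVerdict, PMF.pure_map, A,
            NonadaptiveAlgorithm.run]
        · have := hE E fun t ht => absurd ht (by omega)
          simp [Environment.numDiff] at this
        · intro B hB
          rw [PMF.support_pure, Set.mem_singleton_iff] at hB
          subst hB
          simp only [A, List.length_nil, Nat.cast_zero]
          positivity
      · obtain ⟨Q, hQ, hE⟩ := hC m n ε hε hε'
        obtain ⟨T, hT, hT'⟩ := IsPredictable.exists_tester_of_pos hm hε hε' hQ hE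
        refine ⟨T, fun _ _ => ⟨hT, fun B hB => (hT' B hB).trans ?_⟩⟩
        gcongr
        exact le_max_right _ _
    · exact ⟨PMF.pure A, fun hε hε' => absurd ⟨inferInstance, hε, hε'⟩ h⟩
  choose T hT using key
  exact ⟨_, T, fun m n _ ε hε hε' => hT m n ε hε hε'⟩

/-! ### Light cones, small environments and complementation -/

theorem LocalRule.iterate_step_congr (ρ : LocalRule) {R : Type*} [Ring R] (t : ℕ) {f g : R → Bool}
    {i : R} (h : ∀ d : ℤ, |d| ≤ t → f (i + d) = g (i + d)) :
    ρ.step^[t] f i = ρ.step^[t] g i := by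
  induction t generalizing f g with
  | zero => simpa using h 0 (by simp)
  | succ t ih =>
    rw [Function.iterate_succ_apply, Function.iterate_succ_apply]
    refine ih fun d hd => ?_
    have h1 := h (d - 1) (by push_cast; rw [abs_le] at hd ⊢; omega)
    have h2 := h d (by push_cast; rw [abs_le] at hd ⊢; omega)
    have h3 := h (d + 1) (by push_cast; rw [abs_le] at hd ⊢; omega)
    push_cast at h1 h3
    rw [← add_sub_assoc] at h1
    rw [← add_assoc] at h3
    simp only [LocalRule.step, h1, h2, h3]

/-- Unrolling the cycle: the dynamics can be studied on `ℤ`, where order and distance are available.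
-/
theorem LocalRule.iterate_step_intCast (ρ : LocalRule) {n : ℕ} (t : ℕ) (f : ZMod n → Bool) (z : ℤ) :
    ρ.step^[t] f (z : ZMod n) = ρ.step^[t] (fun z : ℤ => f z) z := by
  induction t generalizing f with
  | zero => rfl
  | succ t ih =>
    rw [Function.iterate_succ_apply, Function.iterate_succ_apply, ih]
    have h : (fun z : ℤ => ρ.step f (z : ZMod n)) = ρ.step fun z : ℤ => f z := by
      funext z
      simp [LocalRule.step]
    rw [h]

/-- It suffices to predict large environments: the value at a point of a small one is determined by
few initial values. -/
theorem IsPredictable.of_large {ρ : LocalRule} {C₀ C : ℝ}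
    (h : ∀ (m n : ℕ) [NeZero n] (ε : ℝ), 0 < ε → ε < 1 → C₀ / ε ^ 3 < m → C₀ / ε ^ 3 < n →
      ∃ Q : Fin m × ZMod n → Finset (Fin m × ZMod n),
        (∀ p, ((Q p).card : ℝ) ≤ C / ε ^ 3) ∧ Predicts ρ ε Q) :
    IsPredictable ρ := by
  classical
  refine ⟨max C (2 * |C₀|), fun m n _ ε hε hε' => ?_⟩
  by_cases hmn : C₀ / ε ^ 3 < m ∧ C₀ / ε ^ 3 < n
  · obtain ⟨Q, hQ, hQ'⟩ := h m n ε hε hε' hmn.1 hmn.2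
    exact ⟨Q, fun p => (hQ p).trans (by gcongr; exact le_max_left _ _), hQ'⟩
  · let Q : Fin m × ZMod n → Finset (Fin m × ZMod n) := fun p =>
      (Finset.Icc (-(p.1 : ℤ)) p.1).image fun d : ℤ => (⟨0, p.1.pos⟩, p.2 + d)
    refine ⟨Q, fun p => ?_, fun E => ?_⟩
    · have hle : ((Q p).card : ℝ) ≤ 2 * m ∧ ((Q p).card : ℝ) ≤ n := by
        constructor
        · have h1 : (Q p).card ≤ _ := Finset.card_image_le
          rw [Int.card_Icc] at h1
          have := p.1.2
          have h2 : (Q p).card ≤ 2 * m := by omega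
          exact_mod_cast h2
        · have h1 : Q p ⊆ ({(⟨0, p.1.pos⟩ : Fin m)} : Finset (Fin m)) ×ˢ
              (Finset.univ : Finset (ZMod n)) := by
            intro q hq
            obtain ⟨d, -, rfl⟩ := Finset.mem_image.1 hq
            simp
          have h2 := Finset.card_le_card h1
          rw [Finset.card_product, Finset.card_singleton, one_mul, Finset.card_univ,
            ZMod.card] at h2
          exact_mod_cast h2
      have h3 : ((Q p).card : ℝ) ≤ 2 * (C₀ / ε ^ 3) := by
        rcases not_and_or.1 hmn with h | h <;> push Not at h
        · linarith [hle.1]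
        · have : (0 : ℝ) ≤ n := by positivity
          linarith [hle.2]
      refine h3.trans ?_
      rw [← mul_div_assoc]
      gcongr
      exact le_trans (by linarith [le_abs_self C₀]) (le_max_right _ _)
    · rcases Nat.eq_zero_or_pos m with rfl | hm
      · exact ⟨fun _ => false, ∅, by simp, fun p => p.1.elim0⟩
      refine ⟨fun i => E ⟨0, hm⟩ i, ∅, by simp only [Finset.card_empty, Nat.cast_zero]; positivity,
        fun p _ f hf => ρ.iterate_step_congr _ fun d hd => ?_⟩
      refine hf (⟨0, hm⟩, p.2 + d) (Finset.mem_image.2 ⟨d, ?_, rfl⟩)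
      rw [Finset.mem_Icc]
      exact abs_le.1 hd

/-- Adding the bit `σ t` to all values at time `t` carries evolutions under `ρ` to evolutions under
`ρ'`, and leaves the queried points unchanged. -/
theorem Predicts.flip {ρ ρ' : LocalRule} (σ : ℕ → Bool)
    (hσ : ∀ t a b c, ρ' (a ^^ σ t) (b ^^ σ t) (c ^^ σ t) = (ρ a b c ^^ σ (t + 1)))
    {m n : ℕ} {ε : ℝ} {Q : Fin m × ZMod n → Finset (Fin m × ZMod n)} (h : Predicts ρ ε Q) :
    Predicts ρ' ε Q := by
  have key : ∀ (f : ZMod n → Bool) (t : ℕ) (i : ZMod n),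
      ρ'.step^[t] (fun i => f i ^^ σ 0) i = (ρ.step^[t] f i ^^ σ t) := by
    intro f t
    induction t with
    | zero => intro i; rfl
    | succ t ih =>
      intro i
      simp only [Function.iterate_succ_apply', LocalRule.step] at ih ⊢
      rw [ih, ih, ih, hσ]
  intro E
  obtain ⟨g, X, hX, hg⟩ := h fun t i => E t i ^^ σ t
  refine ⟨fun i => g i ^^ σ 0, X, hX, fun p hp f hf => ?_⟩
  have hf' : f = fun i => (f i ^^ σ 0) ^^ σ 0 := by simp
  rw [hf', key, key]
  congr 1
  refine hg p hp _ fun q hq => ?_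
  rw [← hf q hq]
  conv_rhs => rw [hf']
  rw [key]
  simp

theorem IsPredictable.flip {ρ ρ' : LocalRule} (h : IsPredictable ρ) (σ : ℕ → Bool)
    (hσ : ∀ t a b c, ρ' (a ^^ σ t) (b ^^ σ t) (c ^^ σ t) = (ρ a b c ^^ σ (t + 1))) :
    IsPredictable ρ' := by
  obtain ⟨C, hC⟩ := h
  refine ⟨C, fun m n _ ε hε hε' => ?_⟩
  obtain ⟨Q, hQ, hQ'⟩ := hC m n ε hε hε'
  exact ⟨Q, hQ, hQ'.flip σ hσ⟩

/-! ### Constant rules and NOR -/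

theorem le_half_mul_of_four_div_lt {m : ℕ} {ε : ℝ} (hε : 0 < ε) (hε' : ε < 1)
    (hm : 4 / ε ^ 3 < m) : 1 ≤ ε / 2 * m := by
  rw [div_lt_iff₀ (by positivity)] at hm
  have h1 : ε ^ 2 ≤ 1 := pow_le_one₀ hε.le hε'.le
  have h2 : (0 : ℝ) ≤ m := by positivity
  nlinarith [mul_nonneg (mul_nonneg h2 hε.le) (sub_nonneg.2 h1)]

theorem card_filter_fst_lt_le (m n T : ℕ) [NeZero n] :
    (Finset.univ.filter fun p : Fin m × ZMod n => (p.1 : ℕ) < T).card ≤ T * n := by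
  classical
  have h : (Finset.univ.filter fun p : Fin m × ZMod n => (p.1 : ℕ) < T).card ≤
      (Finset.range T ×ˢ (Finset.univ : Finset (ZMod n))).card :=
    Finset.card_le_card_of_injOn (fun p => ((p.1 : ℕ), p.2))
      (fun p hp => by simpa using hp)
      (fun p _ q _ hpq => by
        rw [Prod.mk.injEq] at hpq
        exact Prod.ext (Fin.ext hpq.1) hpq.2)
  simpa [ZMod.card] using h

theorem isPredictable_const (α : Bool) : IsPredictable fun _ _ _ => α := by
  refine IsPredictable.of_large (C₀ := 4) (C := 0) fun m n _ ε hε hε' hm _ =>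
    ⟨fun _ => ∅, by simp, fun E => ⟨fun _ => α,
      Finset.univ.filter fun p => (p.1 : ℕ) < 1, ?_, fun p hp f _ => ?_⟩⟩
  · have h1 : ((Finset.univ.filter fun p : Fin m × ZMod n => (p.1 : ℕ) < 1).card : ℝ) ≤ 1 * n := by
      exact_mod_cast card_filter_fst_lt_le m n 1
    exact h1.trans (by gcongr; exact le_half_mul_of_four_div_lt hε hε' hm)
  · have hp' : (p.1 : ℕ) ≠ 0 := by simpa using hp
    obtain ⟨t, ht⟩ := Nat.exists_eq_succ_of_ne_zero hp'
    rw [ht, Function.iterate_succ_apply', Function.iterate_succ_apply']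
    rfl

/-- The rule with value `1` if and only if all three arguments are `0`. -/
def norRule : LocalRule := fun a b c => !(a || b || c)

/-- The NOR step `N` is an antitone Galois connection with itself: `g ≤ N f` if and only if no 1 of
`g` is within distance 1 of a 1 of `f`, a symmetric condition. Hence `N ^ 3 = N`. -/
theorem step_norRule_step_step {R : Type*} [Ring R] (f : R → Bool) :
    norRule.step (norRule.step (norRule.step f)) = norRule.step f := by
  funext i
  simp only [LocalRule.step, norRule, sub_add_cancel, add_sub_cancel_right]
  cases f (i - 1) <;> cases f i <;> cases f (i + 1) <;> simp

theorem iterate_step_norRule_succ {R : Type*} [Ring R] (t : ℕ) :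
    (∀ f : R → Bool, norRule.step^[t + 1] f = norRule.step f) ∨
      (∀ f : R → Bool, norRule.step^[t + 1] f = norRule.step (norRule.step f)) := by
  induction t with
  | zero => exact Or.inl fun f => rfl
  | succ t ih =>
    simp only [Function.iterate_succ_apply' _ (t + 1)]
    rcases ih with h | h
    · exact Or.inr fun f => by rw [h]
    · exact Or.inl fun f => by rw [h, step_norRule_step_step]

theorem isPredictable_norRule : IsPredictable norRule := by
  classical
  refine IsPredictable.of_large (C₀ := 4) (C := 5) fun m n _ ε hε hε' hm _ => ?_
  have hε3 : (1 : ℝ) ≤ 1 / ε ^ 3 := by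
    rw [le_div_iff₀ (by positivity), one_mul]
    exact pow_le_one₀ hε.le hε'.le
  have hm1 : 1 < m := by
    have h1 : 4 / ε ^ 3 = 4 * (1 / ε ^ 3) := by ring
    have : (1 : ℝ) < m := by linarith
    exact_mod_cast this
  -- Both `N f = N (N (N f))` and `N (N f)` are read off from `N f`, the row at time 1, within
  -- radius 2. That row may have no preimage, so `g` is one step after it: this plays the role of `N
  -- (N f)`, which has the same evolution as `f` from time 1 on.
  refine ⟨fun p => (Finset.Icc (-2 : ℤ) 2).image fun d : ℤ => (⟨1, hm1⟩, p.2 + d), fun p => ?_,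
    fun E => ⟨norRule.step (E ⟨1, hm1⟩), Finset.univ.filter fun p => (p.1 : ℕ) < 1, ?_,
      fun p hp f hf => ?_⟩⟩
  · have h1 : ((Finset.Icc (-2 : ℤ) 2).image
        fun d : ℤ => ((⟨1, hm1⟩, p.2 + d) : Fin m × ZMod n)).card ≤ 5 := Finset.card_image_le
    have h2 : (((Finset.Icc (-2 : ℤ) 2).image
        fun d : ℤ => ((⟨1, hm1⟩, p.2 + d) : Fin m × ZMod n)).card : ℝ) ≤ 5 := by exact_mod_cast h1
    have h3 : 5 / ε ^ 3 = 5 * (1 / ε ^ 3) := by ring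
    linarith
  · have h1 : ((Finset.univ.filter fun p : Fin m × ZMod n => (p.1 : ℕ) < 1).card : ℝ) ≤ 1 * n := by
      exact_mod_cast card_filter_fst_lt_le m n 1
    exact h1.trans (by gcongr; exact le_half_mul_of_four_div_lt hε hε' hm)
  · have hp' : (p.1 : ℕ) ≠ 0 := by simpa using hp
    obtain ⟨t, ht⟩ := Nat.exists_eq_succ_of_ne_zero hp'
    have hf' : ∀ d : ℤ, |d| ≤ 2 → norRule.step f (p.2 + d) = E ⟨1, hm1⟩ (p.2 + d) := fun d hd =>
      hf (⟨1, hm1⟩, p.2 + d) (Finset.mem_image.2 ⟨d, Finset.mem_Icc.2 (abs_le.1 hd), rfl⟩)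
    rw [ht]
    rcases iterate_step_norRule_succ (R := ZMod n) t with h | h
    · rw [h, h, ← step_norRule_step_step f]
      exact norRule.iterate_step_congr 2 hf'
    · rw [h, h, step_norRule_step_step]
      exact norRule.iterate_step_congr 1 fun d hd => hf' d (hd.trans (by norm_num))

/-! ### Periodic grids -/

/-- The points `z k` cut the integers into gaps of length between `s` and `2 * s`, and `κ j` is the
index of the gap that contains `j`. -/
structure IsGrid (s : ℤ) (z κ : ℤ → ℤ) : Prop where
  le_gap : ∀ k, z k + s ≤ z (k + 1)
  gap_le : ∀ k, z (k + 1) ≤ z k + 2 * s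
  idx_le : ∀ j, z (κ j) ≤ j
  lt_idx : ∀ j, j < z (κ j + 1)

namespace IsGrid

variable {s : ℤ} {z κ : ℤ → ℤ}

theorem mul_le (h : IsGrid s z κ) {k l : ℤ} (hkl : k ≤ l) : s * (l - k) ≤ z l - z k := by
  induction l, hkl using Int.leInduction with
  | base => simp
  | succ l _ ih => have := h.le_gap l; nlinarith

theorem mono (h : IsGrid s z κ) (hs : 0 < s) {k l : ℤ} (hkl : k ≤ l) : z k ≤ z l := by
  have := h.mul_le hkl
  nlinarith

theorem idx_eq (h : IsGrid s z κ) (hs : 0 < s) {j k : ℤ} (h1 : z k ≤ j) (h2 : j < z (k + 1)) :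
    κ j = k := by
  have h3 := h.idx_le j
  have h4 := h.lt_idx j
  rcases lt_trichotomy (κ j) k with hlt | heq | hgt
  · have := h.mono hs (show κ j + 1 ≤ k by omega); omega
  · exact heq
  · have := h.mono hs (show k + 1 ≤ κ j by omega); omega

end IsGrid

/-- Grid points with gaps of length about `s`, periodic modulo `n`. -/
def gridPt (n s : ℕ) (k : ℤ) : ℤ :=
  n * (k / (n / s : ℕ)) + s * (k % (n / s : ℕ))

/-- The index of the gap of the grid that contains `j`. -/
def gridIdx (n s : ℕ) (j : ℤ) : ℤ :=
  (n / s : ℕ) * (j / n) + min (j % n / s) ((n / s : ℕ) - 1)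

theorem gridPt_add (n s : ℕ) (hs : 0 < s) (hsn : s ≤ n) (k : ℤ) :
    gridPt n s (k + (n / s : ℕ)) = gridPt n s k + n := by
  have hN : ((n / s : ℕ) : ℤ) ≠ 0 := by
    have := Nat.div_pos hsn hs; omega
  unfold gridPt
  rw [Int.add_ediv_of_dvd_right (dvd_refl _), Int.ediv_self hN, Int.add_emod_right]
  ring

theorem gridPt_add_mul (n s : ℕ) (hs : 0 < s) (hsn : s ≤ n) (k l : ℤ) :
    gridPt n s (k + (n / s : ℕ) * l) = gridPt n s k + n * l := by
  have hN : ((n / s : ℕ) : ℤ) ≠ 0 := by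
    have := Nat.div_pos hsn hs; omega
  unfold gridPt
  rw [Int.add_mul_ediv_left _ _ hN, Int.add_mul_emod_self_left]
  ring

theorem gridIdx_add (n s : ℕ) (hn : 0 < n) (j : ℤ) :
    gridIdx n s (j + n) = gridIdx n s j + (n / s : ℕ) := by
  have hn' : (n : ℤ) ≠ 0 := by omega
  unfold gridIdx
  rw [Int.add_ediv_of_dvd_right (dvd_refl _), Int.ediv_self hn', Int.add_emod_right]
  ring

theorem gridPt_mul_add {n s : ℕ} {q r : ℤ} (hr : 0 ≤ r) (hr' : r < (n / s : ℕ)) :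
    gridPt n s ((n / s : ℕ) * q + r) = n * q + s * r := by
  have hN : ((n / s : ℕ) : ℤ) ≠ 0 := by omega
  unfold gridPt
  rw [add_comm _ r, Int.add_mul_ediv_left _ _ hN, Int.add_mul_emod_self_left,
    Int.ediv_eq_zero_of_lt hr hr', Int.emod_eq_of_lt hr hr', zero_add]

/-- All gaps in a period have length `s` except the last, which absorbs the remainder `n % s < s`.
-/
theorem isGrid_gridPt {n s : ℕ} (hs : 0 < s) (hsn : s ≤ n) :
    IsGrid s (gridPt n s) (gridIdx n s) := by
  have hN : 0 < n / s := Nat.div_pos hsn hs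
  have hn : (n : ℤ) = s * (n / s : ℕ) + (n % s : ℕ) := by
    exact_mod_cast (Nat.div_add_mod n s).symm
  have hmod : ((n % s : ℕ) : ℤ) < s := by exact_mod_cast Nat.mod_lt n hs
  have hmod' : (0 : ℤ) ≤ (n % s : ℕ) := by positivity
  have hs' : (0 : ℤ) < s := by exact_mod_cast hs
  have hN' : (0 : ℤ) < (n / s : ℕ) := by exact_mod_cast hN
  -- the gap following the grid point with index `N * q + r`
  have gap : ∀ q r : ℤ, 0 ≤ r → r < (n / s : ℕ) →
      (r + 1 < (n / s : ℕ) → gridPt n s ((n / s : ℕ) * q + r + 1) = n * q + s * r + s) ∧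
      (r + 1 = (n / s : ℕ) → gridPt n s ((n / s : ℕ) * q + r + 1) = n * q + n) := by
    intro q r h0 h1
    refine ⟨fun h => ?_, fun h => ?_⟩
    · rw [add_assoc, gridPt_mul_add (by omega) h]; ring
    · have : ((n / s : ℕ) : ℤ) * q + r + 1 = (n / s : ℕ) * (q + 1) + 0 := by
        rw [add_assoc, h]; ring
      rw [this, gridPt_mul_add le_rfl hN']; ring
  have hgap : ∀ k, gridPt n s k + s ≤ gridPt n s (k + 1) ∧
      gridPt n s (k + 1) ≤ gridPt n s k + 2 * s := by
    intro k
    have h0 := Int.emod_nonneg k hN'.ne'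
    have h1 := Int.emod_lt_of_pos k hN'
    rw [← Int.mul_ediv_add_emod k (n / s : ℕ)]
    generalize k / ((n / s : ℕ) : ℤ) = q at *
    generalize k % ((n / s : ℕ) : ℤ) = r at *
    rw [gridPt_mul_add h0 h1]
    rcases lt_or_eq_of_le (Int.add_one_le_iff.2 h1) with h | h
    · rw [(gap q r h0 h1).1 h]; constructor <;> omega
    · rw [(gap q r h0 h1).2 h]
      rw [← h] at hn
      constructor <;> nlinarith
  have hidx : ∀ j, gridPt n s (gridIdx n s j) ≤ j ∧ j < gridPt n s (gridIdx n s j + 1) := by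
    intro j
    have hn0 : (0 : ℤ) < n := by nlinarith
    have h0 := Int.emod_nonneg j hn0.ne'
    have h1 := Int.emod_lt_of_pos j hn0
    have hj := Int.mul_ediv_add_emod j n
    unfold gridIdx
    generalize j / (n : ℤ) = q at *
    generalize j % (n : ℤ) = r at *
    have h2 := Int.mul_ediv_add_emod r s
    have h3 := Int.emod_nonneg r hs'.ne'
    have h4 := Int.emod_lt_of_pos r hs'
    have h5 : 0 ≤ r / (s : ℤ) := Int.ediv_nonneg h0 hs'.le
    generalize r / (s : ℤ) = a at *
    generalize r % (s : ℤ) = b at *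
    rcases le_or_gt a ((n / s : ℕ) - 2) with h | h
    · rw [min_eq_left (by omega), gridPt_mul_add h5 (by omega),
        (gap q a h5 (by omega)).1 (by omega)]
      constructor <;> omega
    · rw [min_eq_right (by omega), gridPt_mul_add (by omega) (by omega),
        (gap q _ (by omega) (by omega)).2 (by omega)]
      constructor
      · nlinarith
      · omega
  exact ⟨fun k => (hgap k).1, fun k => (hgap k).2, fun j => (hidx j).1, fun j => (hidx j).2⟩

theorem intCast_gridPt_emod (n s : ℕ) (hs : 0 < s) (hsn : s ≤ n) (k l : ℤ) :
    ((gridPt n s (k + (l - k) % (n / s : ℕ)) : ℤ) : ZMod n) = (gridPt n s l : ℤ) := by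
  have h1 := Int.mul_ediv_add_emod (l - k) (n / s : ℕ)
  have h2 : l = k + (l - k) % (n / s : ℕ) + (n / s : ℕ) * ((l - k) / (n / s : ℕ)) := by linarith
  conv_rhs => rw [h2, gridPt_add_mul n s hs hsn]
  simp

/-- The points at the times `τ₁` and `τ₂` near the grid points around `p` or near the column
of `p`. -/
noncomputable def gridQueries {m n : ℕ} (s : ℕ) (τ₁ τ₂ : Fin m) (p : Fin m × ZMod n) :
    Finset (Fin m × ZMod n) :=
  ((({τ₁, τ₂} : Finset (Fin m)) ×ˢ Finset.Icc (-3 : ℤ) 3 ×ˢ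
      Finset.Icc (gridIdx n s p.2.val - (min (2 * m) n / s + 2 : ℕ))
        (gridIdx n s p.2.val + (min (2 * m) n / s + 2 : ℕ))).image
      fun x => (x.1, ((gridPt n s x.2.2 + x.2.1 : ℤ) : ZMod n))) ∪
    ((({τ₁, τ₂} : Finset (Fin m)) ×ˢ Finset.Icc (-3 : ℤ) 3).image
      fun x => (x.1, ((p.2.val + x.2 : ℤ) : ZMod n)))

theorem card_gridQueries_le {m n : ℕ} (s : ℕ) (τ₁ τ₂ : Fin m) (p : Fin m × ZMod n) :
    (gridQueries s τ₁ τ₂ p).card ≤ 28 * (min (2 * m) n / s) + 84 := by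
  have h2 : ({τ₁, τ₂} : Finset (Fin m)).card ≤ 2 := Finset.card_le_two
  have h7 : (Finset.Icc (-3 : ℤ) 3).card = 7 := rfl
  refine (Finset.card_union_le _ _).trans ?_
  refine (add_le_add Finset.card_image_le Finset.card_image_le).trans ?_
  rw [Finset.card_product, Finset.card_product, Finset.card_product, h7, Int.card_Icc]
  generalize ({τ₁, τ₂} : Finset (Fin m)).card = c at *
  generalize min (2 * m) n / s = K
  have h3 : (gridIdx n s p.2.val + (K + 2 : ℕ) + 1 -
      (gridIdx n s p.2.val - (K + 2 : ℕ))).toNat = 2 * K + 5 := by omega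
  rw [h3]
  nlinarith

/-- If `2 * m ≤ n`, gaps of length at least `s` leave few indices within the distance; otherwise the
`n / s` indices of one period already represent every grid point modulo `n`. -/
theorem exists_gridIdx_near {m n s : ℕ} (hs : 0 < s) (hsn : s ≤ n) {i k : ℤ}
    (hk : |gridPt n s k - i| ≤ 2 * m - 2 * s) :
    ∃ l, |l - gridIdx n s i| ≤ (min (2 * m) n / s + 2 : ℕ) ∧
      ((gridPt n s l : ℤ) : ZMod n) = (gridPt n s k : ℤ) := by
  have hg := isGrid_gridPt hs hsn
  have hN : (0 : ℤ) < (n / s : ℕ) := by exact_mod_cast Nat.div_pos hsn hs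
  have hs' : (0 : ℤ) < s := by exact_mod_cast hs
  rcases le_total (2 * m) n with h | h
  · refine ⟨k, ?_, rfl⟩
    rw [min_eq_left h]
    have h1 := hg.idx_le i
    have h2 := hg.lt_idx i
    have h3 := hg.gap_le (gridIdx n s i)
    have h4 : ((2 * m : ℕ) : ℤ) < s * ((2 * m / s : ℕ) + 1) := by
      exact_mod_cast Nat.lt_mul_div_succ (2 * m) hs
    push_cast at h4 ⊢
    rw [abs_le] at hk ⊢
    generalize (2 * (m : ℤ)) / s = a at *
    rcases le_total k (gridIdx n s i) with hle | hle
    · have := hg.mul_le hle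
      constructor
      · by_contra hlt
        have : (s : ℤ) * (a + 2) ≤ s * (gridIdx n s i - k) :=
          mul_le_mul_of_nonneg_left (by omega) hs'.le
        nlinarith
      · have : 0 ≤ a := by nlinarith
        omega
    · have := hg.mul_le hle
      constructor
      · have : 0 ≤ a := by nlinarith
        omega
      · by_contra hlt
        have : (s : ℤ) * (a + 2) ≤ s * (k - gridIdx n s i) :=
          mul_le_mul_of_nonneg_left (by omega) hs'.le
        nlinarith
  · refine ⟨_, ?_, intCast_gridPt_emod n s hs hsn (gridIdx n s i) k⟩
    rw [min_eq_right h, add_sub_cancel_left]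
    have h0 := Int.emod_nonneg (k - gridIdx n s i) hN.ne'
    have h1 := Int.emod_lt_of_pos (k - gridIdx n s i) hN
    rw [abs_of_nonneg h0]
    push_cast at h1 ⊢
    omega

/-! ### Counting exceptional points -/

/-- An antitone predicate fails from a single time on, and all times in `S` are close to it. -/
theorem card_transitions_le {m : ℕ} {P : ℕ → Prop} (hP : Antitone P) (a b : ℕ)
    (S : Finset (Fin m)) (hS : ∀ t ∈ S, P (t - a) ∧ ¬ P (t + b)) : S.card ≤ a + b := by
  classical
  by_cases h : ∃ t, ¬ P t
  · have h1 : S.card ≤ (Finset.Ico (Nat.find h - b) (Nat.find h + a)).card := by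
      refine Finset.card_le_card_of_injOn (fun t : Fin m => (t : ℕ)) (fun t ht => ?_)
        (fun _ _ _ _ h => Fin.ext h)
      obtain ⟨h1, h2⟩ := hS t ht
      have h3 := Nat.find_min' h h2
      have h4 : (t : ℕ) - a < Nat.find h := by
        by_contra hle
        exact Nat.find_spec h (hP (not_lt.1 hle) h1)
      rw [Finset.coe_Ico, Set.mem_Ico]
      dsimp only
      omega
    rw [Nat.card_Ico] at h1
    omega
  · push Not at h
    have : S = ∅ := Finset.eq_empty_of_forall_notMem fun t ht => (hS t ht).2 (h _)
    simp [this]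

theorem card_filter_transitions_le (m n : ℕ) [NeZero n] {P : ZMod n → ℕ → Prop}
    (hP : ∀ i, Antitone (P i)) (a b : ℕ) (S : Finset (Fin m × ZMod n))
    (hS : ∀ p ∈ S, P p.2 (p.1 - a) ∧ ¬ P p.2 (p.1 + b)) : S.card ≤ (a + b) * n := by
  classical
  have h := Finset.card_le_mul_card_image_of_maps_to (s := S)
    (t := (Finset.univ : Finset (ZMod n))) (f := Prod.snd) (fun _ _ => Finset.mem_univ _) (a + b)
    fun i _ => by
      have h1 := card_transitions_le (hP i) a b ((S.filter fun p => p.2 = i).image Prod.fst)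
        (by
          intro t ht
          obtain ⟨p, hp, rfl⟩ := Finset.mem_image.1 ht
          obtain ⟨hp1, rfl⟩ := Finset.mem_filter.1 hp
          exact hS p hp1)
      rwa [Finset.card_image_of_injOn] at h1
      intro p hp q hq hpq
      have hp' := (Finset.mem_filter.1 hp).2
      have hq' := (Finset.mem_filter.1 hq).2
      exact Prod.ext hpq (hp'.trans hq'.symm)
  simpa [ZMod.card] using h

/-- Cut the cycle into blocks of length `D`: in each block all points of `B` are within `w` of the
smallest one. -/
theorem card_le_of_sparse {n : ℕ} [NeZero n] {D w : ℕ} (hD : 0 < D) (B : Finset (ZMod n))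
    (hB : ∀ i ∈ B, ∀ j ∈ B, i.val ≤ j.val → j.val ≤ i.val + w ∨ i.val + D ≤ j.val) :
    B.card ≤ (n / D + 1) * (w + 1) := by
  classical
  have h := Finset.card_le_mul_card_image_of_maps_to (s := B)
    (t := Finset.range (n / D + 1)) (f := fun i : ZMod n => i.val / D)
    (fun i _ => Finset.mem_range.2 (Nat.lt_succ_of_le (Nat.div_le_div_right (ZMod.val_lt i).le)))
    (w + 1) fun b _ => by
      rcases (B.filter fun i => i.val / D = b).eq_empty_or_nonempty with h | h
      · rw [h]; simp
      · obtain ⟨i, hi, hmin⟩ := Finset.exists_min_image _ ZMod.val h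
        have h1 : (B.filter fun i => i.val / D = b).card ≤
            (Finset.Icc i.val (i.val + w)).card := by
          refine Finset.card_le_card_of_injOn ZMod.val (fun j hj => ?_)
            (ZMod.val_injective n).injOn
          have hij := hmin j hj
          obtain ⟨hi1, hi2⟩ := Finset.mem_filter.1 hi
          obtain ⟨hj1, hj2⟩ := Finset.mem_filter.1 hj
          rw [Finset.coe_Icc, Set.mem_Icc]
          refine ⟨hij, (hB i hi1 j hj1 hij).resolve_right fun hlt => ?_⟩
          have h2 := Nat.div_le_div_right (c := D) hlt
          rw [Nat.add_div_right _ hD] at h2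
          omega
        rw [Nat.card_Icc] at h1
        omega
  rw [Finset.card_range] at h
  rw [mul_comm]
  exact h

theorem card_near_grid_le {n s : ℕ} [NeZero n] (hs : 0 < s) (hsn : s ≤ n) (B : Finset (ZMod n))
    (hB : ∀ i ∈ B, ∃ k : ℤ, |(i.val : ℤ) - gridPt n s k| ≤ 5) : B.card ≤ (n / s) * 11 := by
  classical
  have hN : (0 : ℤ) < (n / s : ℕ) := by exact_mod_cast Nat.div_pos hsn hs
  have h : B ⊆ ((Finset.Ico (0 : ℤ) (n / s : ℕ)) ×ˢ Finset.Icc (-5 : ℤ) 5).image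
      fun x => ((gridPt n s x.1 + x.2 : ℤ) : ZMod n) := by
    intro i hi
    obtain ⟨k, hk⟩ := hB i hi
    have h1 := intCast_gridPt_emod n s hs hsn 0 k
    rw [zero_add, sub_zero] at h1
    refine Finset.mem_image.2 ⟨(k % (n / s : ℕ), (i.val : ℤ) - gridPt n s k), ?_, ?_⟩
    · exact Finset.mem_product.2 ⟨Finset.mem_Ico.2 ⟨Int.emod_nonneg _ hN.ne',
        Int.emod_lt_of_pos _ hN⟩, Finset.mem_Icc.2 (abs_le.1 hk)⟩
    · push_cast at h1 ⊢
      rw [h1]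
      simp
  refine (Finset.card_le_card h).trans (Finset.card_image_le.trans ?_)
  rw [Finset.card_product, Int.card_Ico, Int.card_Icc]
  simp

/-! ### Scales and the grid criterion -/

/-- With `L = min m n`, take `s` about `ε ^ 2 * L / 3920` and `Δ = 2 * q * s` with `q = ⌈48 / ε⌉`.
Since `q * ε ≤ 49`, the condition `40 * Δ ≤ ε * L` follows from `3920 = 80 * 49`; the bound `300000`
makes `s` large enough to absorb rounding. -/
theorem exists_scales {m n : ℕ} {ε : ℝ} (hε : 0 < ε) (hε' : ε < 1) (hm : 300000 / ε ^ 3 < m)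
    (hn : 300000 / ε ^ 3 < n) :
    ∃ s Δ : ℕ, 66 ≤ ε * s ∧ Even Δ ∧ 48 * s ≤ ε * Δ ∧ 40 * Δ ≤ ε * m ∧ 40 * Δ ≤ ε * n ∧
      (min m n : ℕ) ≤ 4000 / ε ^ 2 * s := by
  have hL : 300000 / ε ^ 3 < (min m n : ℕ) := by
    rw [Nat.cast_min]; exact lt_min hm hn
  have hLm : ((min m n : ℕ) : ℝ) ≤ m := by exact_mod_cast min_le_left m n
  have hLn : ((min m n : ℕ) : ℝ) ≤ n := by exact_mod_cast min_le_right m n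
  generalize min m n = L at *
  rw [div_lt_iff₀ (by positivity)] at hL
  have hL0 : (0 : ℝ) ≤ L := by positivity
  obtain ⟨s, hs⟩ : ∃ s : ℕ, s = ⌊ε ^ 2 * L / 3920⌋₊ := ⟨_, rfl⟩
  obtain ⟨q, hq⟩ : ∃ q : ℕ, q = ⌈48 / ε⌉₊ := ⟨_, rfl⟩
  have hs1 : (s : ℝ) ≤ ε ^ 2 * L / 3920 := by
    rw [hs]; exact Nat.floor_le (by positivity)
  have hs2 : ε ^ 2 * L / 3920 < s + 1 := by
    rw [hs]; exact Nat.lt_floor_add_one _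
  have hq1 : 48 ≤ q * ε := by
    rw [← div_le_iff₀ hε, hq]; exact Nat.le_ceil _
  have hq2 : q * ε ≤ 49 := by
    have : (q : ℝ) < 48 / ε + 1 := by
      rw [hq]; exact Nat.ceil_lt_add_one (by positivity)
    have h2 := mul_lt_mul_of_pos_right this hε
    rw [add_mul, div_mul_cancel₀ _ hε.ne'] at h2
    linarith
  have hbig : 300000 ≤ ε ^ 2 * L := by
    have : 0 ≤ ε ^ 2 * L := by positivity
    nlinarith
  have hs0 : (0 : ℝ) ≤ s := by positivity
  have hΔ : 40 * (2 * (q * s : ℝ)) ≤ ε * L := by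
    have h1 : ε * (40 * (2 * (q * s : ℝ))) ≤ ε * (ε * L) := by
      have : ε * (40 * (2 * (q * s : ℝ))) = 80 * (q * ε) * s := by ring
      rw [this]
      nlinarith
    exact le_of_mul_le_mul_left h1 hε
  refine ⟨s, 2 * (q * s), ?_, even_two_mul _, ?_, ?_, ?_, ?_⟩
  · have : ε * (ε ^ 2 * L / 3920) < ε * (s + 1) := mul_lt_mul_of_pos_left hs2 hε
    nlinarith
  · push_cast
    nlinarith
  · push_cast
    exact hΔ.trans (by gcongr)
  · push_cast
    exact hΔ.trans (by gcongr)
  · rw [div_mul_eq_mul_div, le_div_iff₀ (by positivity)]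
    nlinarith

/-- A criterion for predictability: up to errors that are rare, the value of an evolving
environment at time `t` and location `i` is determined by its values at two times `Δ` and
`Δ + 2 * s` near the points of a grid and near `i`. -/
theorem IsPredictable.of_grid {ρ : LocalRule}
    (h : ∀ (n s Δ : ℕ) [NeZero n], 66 ≤ s → 48 * s ≤ Δ → Even Δ → Δ ≤ n →
      ∀ e₁ e₂ : ZMod n → Bool, ∃ (g : ZMod n → Bool) (P : ZMod n → ℕ → Prop) (B : Finset (ZMod n)),
        (∀ i, Antitone (P i)) ∧ B.card ≤ (n / Δ + 1) * (3 * s + 1) ∧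
        ∀ i ∉ B, (∀ k, 5 < |(i.val : ℤ) - gridPt n s k|) →
        ∀ t, 2 * Δ ≤ t → (P i (t - 2 * Δ) → P i (t + 2 * Δ)) →
        ∀ f : ZMod n → Bool,
          (∀ k, |gridPt n s k - i.val| ≤ t + 2 * Δ → ∀ d : ℤ, |d| ≤ 3 →
            ρ.step^[Δ] f ((gridPt n s k + d : ℤ) : ZMod n) = e₁ (gridPt n s k + d : ℤ) ∧
            ρ.step^[Δ + 2 * s] f ((gridPt n s k + d : ℤ) : ZMod n) = e₂ (gridPt n s k + d : ℤ)) →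
          (∀ d : ℤ, |d| ≤ 3 →
            ρ.step^[Δ] f ((i.val + d : ℤ) : ZMod n) = e₁ (i.val + d : ℤ) ∧
            ρ.step^[Δ + 2 * s] f ((i.val + d : ℤ) : ZMod n) = e₂ (i.val + d : ℤ)) →
          ρ.step^[t] f i = ρ.step^[t] g i) :
    IsPredictable ρ := by
  classical
  refine IsPredictable.of_large (C₀ := 300000) (C := 300000) fun m n _ ε hε hε' hm hn => ?_
  obtain ⟨s, Δ, h1, hΔ, h2, h3, h4, h5⟩ := exists_scales hε hε' hm hn
  have hs0 : (0 : ℝ) ≤ s := by positivity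
  have hΔ0 : (0 : ℝ) ≤ Δ := by positivity
  have hm0 : (0 : ℝ) ≤ m := by positivity
  have hn0 : (0 : ℝ) ≤ n := by positivity
  have hs : 66 ≤ s := by
    have : (66 : ℝ) ≤ s := by nlinarith
    exact_mod_cast this
  have hsΔ : 48 * s ≤ Δ := by
    have : (48 * s : ℝ) ≤ Δ := by nlinarith
    exact_mod_cast this
  have hΔm : 40 * Δ ≤ m := by
    have : (40 * Δ : ℝ) ≤ m := by nlinarith
    exact_mod_cast this
  have hΔn : 40 * Δ ≤ n := by
    have : (40 * Δ : ℝ) ≤ n := by nlinarith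
    exact_mod_cast this
  have hsn : s ≤ n := by omega
  let τ₁ : Fin m := ⟨Δ, by omega⟩
  let τ₂ : Fin m := ⟨Δ + 2 * s, by omega⟩
  refine ⟨gridQueries s τ₁ τ₂, fun p => ?_, fun E => ?_⟩
  · have hc : ((gridQueries s τ₁ τ₂ p).card : ℝ) ≤ 28 * ((min (2 * m) n / s : ℕ) : ℝ) + 84 := by
      exact_mod_cast card_gridQueries_le s τ₁ τ₂ p
    have hK : ((min (2 * m) n / s : ℕ) : ℝ) ≤ 8000 / ε ^ 2 := by
      refine Nat.cast_div_le.trans ?_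
      rw [div_le_iff₀ (by positivity)]
      have : min (2 * m) n ≤ 2 * min m n := by omega
      have : ((min (2 * m) n : ℕ) : ℝ) ≤ 2 * (min m n : ℕ) := by exact_mod_cast this
      have h6 : 8000 / ε ^ 2 * (s : ℝ) = 2 * (4000 / ε ^ 2 * s) := by ring
      linarith
    -- The grid itself needs only `O(1 / ε ^ 2)` queries; the third power is the cost of small
    -- environments.
    have h7 : 8000 / ε ^ 2 ≤ 8000 / ε ^ 3 :=
      div_le_div_of_nonneg_left (by norm_num) (by positivity)
        (pow_le_pow_of_le_one hε.le hε'.le (by norm_num))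
    have h8 : 1 ≤ 1 / ε ^ 3 := by
      rw [le_div_iff₀ (by positivity), one_mul]
      exact pow_le_one₀ hε.le hε'.le
    have h9 : 8000 / ε ^ 3 = 8000 * (1 / ε ^ 3) := by ring
    have h10 : 300000 / ε ^ 3 = 300000 * (1 / ε ^ 3) := by ring
    linarith
  · obtain ⟨g, P, B, hP, hB, hg⟩ := h n s Δ hs hsΔ hΔ (by omega) (E τ₁) (E τ₂)
    let X₁ : Finset (Fin m × ZMod n) := Finset.univ.filter fun p => (p.1 : ℕ) < 2 * Δ
    let X₂ : Finset (Fin m × ZMod n) :=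
      Finset.univ.filter fun p => P p.2 (p.1 - 2 * Δ) ∧ ¬ P p.2 (p.1 + 2 * Δ)
    let B' : Finset (ZMod n) :=
      Finset.univ.filter fun i => ∃ k : ℤ, |(i.val : ℤ) - gridPt n s k| ≤ 5
    have hB' : B'.card ≤ (n / s) * 11 :=
      card_near_grid_le (by omega) hsn B' fun i hi => (Finset.mem_filter.1 hi).2
    have hX₂ : X₂.card ≤ (2 * Δ + 2 * Δ) * n :=
      card_filter_transitions_le m n hP _ _ X₂ fun p hp => (Finset.mem_filter.1 hp).2
    refine ⟨g, (X₁ ∪ X₂) ∪ Finset.univ ×ˢ (B ∪ B'), ?_, fun p hp f hf => ?_⟩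
    · have hc : ((X₁ ∪ X₂) ∪ Finset.univ ×ˢ (B ∪ B')).card ≤ (2 * Δ * n + (2 * Δ + 2 * Δ) * n) +
          m * ((n / Δ + 1) * (3 * s + 1) + (n / s) * 11) := by
        refine (Finset.card_union_le _ _).trans (add_le_add ?_ ?_)
        · exact (Finset.card_union_le _ _).trans
            (add_le_add (card_filter_fst_lt_le m n _) hX₂)
        · rw [Finset.card_product, Finset.card_univ, Fintype.card_fin]
          exact Nat.mul_le_mul_left _ ((Finset.card_union_le _ _).trans (add_le_add hB hB'))
      have hc' : (((X₁ ∪ X₂) ∪ Finset.univ ×ˢ (B ∪ B')).card : ℝ) ≤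
          (2 * Δ * n + (2 * Δ + 2 * Δ) * n) +
          m * (((n / Δ : ℕ) + 1) * (3 * s + 1) + (n / s : ℕ) * 11) := by exact_mod_cast hc
      refine hc'.trans ?_
      have hΔpos : (0 : ℝ) < Δ := by
        have : 0 < Δ := by omega
        exact_mod_cast this
      have hspos : (0 : ℝ) < s := by
        have : 0 < s := by omega
        exact_mod_cast this
      have hnΔ : ((n / Δ : ℕ) : ℝ) ≤ n / Δ := Nat.cast_div_le
      have hns : ((n / s : ℕ) : ℝ) ≤ n / s := Nat.cast_div_le
      have hnΔ' : (1 : ℝ) ≤ n / Δ := by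
        rw [le_div_iff₀ hΔpos, one_mul]
        have : Δ ≤ n := by omega
        exact_mod_cast this
      -- Error budget: `6/40` for early times and transitions, `1/6` for columns near the grid and
      -- `1/6` for `B`, together less than `1/2`.
      have e1 : (2 * Δ * n + (2 * Δ + 2 * Δ) * n : ℝ) ≤ ε * (6 / 40) * m * n := by nlinarith
      have e2 : ((n / s : ℕ) * 11 : ℝ) ≤ ε / 6 * n := by
        have : (n / s * 11 : ℝ) ≤ ε / 6 * n := by
          rw [div_mul_eq_mul_div, div_le_iff₀ hspos]
          nlinarith
        linarith
      have e3 : (((n / Δ : ℕ) + 1) * (3 * s + 1) : ℝ) ≤ ε / 6 * n := by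
        have a1 : (((n / Δ : ℕ) + 1) * (3 * s + 1) : ℝ) ≤ (2 * (n / Δ)) * (4 * s) := by
          have : (66 : ℝ) ≤ s := by exact_mod_cast hs
          gcongr <;> linarith
        refine a1.trans ?_
        have a2 : (2 * (n / Δ)) * (4 * s) = (8 * s * n : ℝ) / Δ := by ring
        rw [a2, div_le_iff₀ hΔpos]
        nlinarith
      have e4 : (m : ℝ) * (((n / Δ : ℕ) + 1) * (3 * s + 1) + (n / s : ℕ) * 11) ≤
          m * (ε / 6 * n + ε / 6 * n) := by gcongr
      have e5 : 0 ≤ ε * m * n := by positivity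
      nlinarith
    · simp only [Finset.mem_union, Finset.mem_product, Finset.mem_univ, true_and, not_or,
        Finset.mem_filter, X₁, X₂, B', not_lt, not_and, not_not, not_exists, not_le] at hp
      obtain ⟨⟨hp1, hp2⟩, hp3, hp4⟩ := hp
      have hmem : ∀ q ∈ gridQueries s τ₁ τ₂ p, ρ.step^[(q.1 : ℕ)] f q.2 = E q.1 q.2 := hf
      refine hg p.2 hp3 hp4 p.1 hp1 hp2 f (fun k hk d hd => ?_) (fun d hd => ?_)
      · obtain ⟨l, hl, hlk⟩ := exists_gridIdx_near (m := m) (n := n) (s := s) (i := p.2.val)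
          (k := k) (by omega) hsn (by have := p.1.2; omega)
        have hmem' : ∀ τ ∈ ({τ₁, τ₂} : Finset (Fin m)),
            (τ, ((gridPt n s k + d : ℤ) : ZMod n)) ∈ gridQueries s τ₁ τ₂ p := by
          intro τ hτ
          refine Finset.mem_union_left _ (Finset.mem_image.2 ⟨(τ, d, l), ?_, ?_⟩)
          · rw [abs_le] at hl hd
            simp only [Finset.mem_product, Finset.mem_Icc]
            refine ⟨hτ, hd, ?_⟩
            omega
          · push_cast
            rw [hlk]
        exact ⟨hmem _ (hmem' τ₁ (by simp)), hmem _ (hmem' τ₂ (by simp))⟩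
      · have hmem' : ∀ τ ∈ ({τ₁, τ₂} : Finset (Fin m)),
            (τ, ((p.2.val + d : ℤ) : ZMod n)) ∈ gridQueries s τ₁ τ₂ p := by
          intro τ hτ
          refine Finset.mem_union_right _ (Finset.mem_image.2 ⟨(τ, d), ?_, rfl⟩)
          exact Finset.mem_product.2 ⟨hτ, Finset.mem_Icc.2 (abs_le.1 hd)⟩
        exact ⟨hmem _ (hmem' τ₁ (by simp)), hmem _ (hmem' τ₂ (by simp))⟩

/-! ### The OR rule -/

/-- The rule with value `1` if and only if some argument is `1`. -/
def orRule : LocalRule := fun a b c => a || b || c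

theorem iterate_step_orRule {R : Type*} [Ring R] (t : ℕ) (f : R → Bool) (i : R) :
    orRule.step^[t] f i = true ↔ ∃ d : ℤ, |d| ≤ t ∧ f (i + d) = true := by
  induction t generalizing f i with
  | zero => simp
  | succ t ih =>
    rw [Function.iterate_succ_apply', LocalRule.step]
    simp only [orRule, Bool.or_eq_true, ih]
    push_cast
    constructor
    · rintro ((⟨d, hd, h⟩ | ⟨d, hd, h⟩) | ⟨d, hd, h⟩)
      · refine ⟨d - 1, by rw [abs_le] at *; omega, ?_⟩
        rw [← h]; congr 1; push_cast; abel
      · exact ⟨d, by rw [abs_le] at *; omega, h⟩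
      · refine ⟨d + 1, by rw [abs_le] at *; omega, ?_⟩
        rw [← h]; congr 1; push_cast; abel
    · rintro ⟨d, hd, h⟩
      rw [abs_le] at hd
      rcases lt_trichotomy d 0 with h0 | h0 | h0
      · refine Or.inl (Or.inl ⟨d + 1, by rw [abs_le]; omega, ?_⟩)
        rw [← h]; congr 1; push_cast; abel
      · exact Or.inl (Or.inr ⟨d, by rw [abs_le]; omega, h⟩)
      · refine Or.inr ⟨d - 1, by rw [abs_le]; omega, ?_⟩
        rw [← h]; congr 1; push_cast; abel

theorem isPredictable_orRule : IsPredictable orRule := by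
  classical
  refine IsPredictable.of_grid fun n s Δ _ hs hsΔ _ hΔn e₁ e₂ => ?_
  have hs0 : 0 < s := by omega
  have hsn : s ≤ n := by omega
  have hgrid := isGrid_gridPt hs0 hsn
  -- A 1 at time 0 forces 1s at time `Δ` on all grid points within `Δ`; `g` has a 1 wherever this is
  -- not contradicted, so it dominates `f` on the light cone.
  let g : ZMod n → Bool := fun x =>
    decide (∀ k d : ℤ, |d| ≤ Δ → x = gridPt n s k + d → e₁ (gridPt n s k) = true)
  have hmono : ∀ i t t', t ≤ t' → orRule.step^[t] g i = true → orRule.step^[t'] g i = true := by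
    intro i t t' htt' h
    rw [iterate_step_orRule] at h ⊢
    obtain ⟨d, hd, h⟩ := h
    exact ⟨d, hd.trans (by exact_mod_cast htt'), h⟩
  refine ⟨g, fun i t => orRule.step^[t] g i = false, ∅, ?_, by simp, ?_⟩
  · intro i t t' htt' h
    by_contra hne
    rw [Bool.not_eq_false] at hne
    have := hmono i t t' htt' hne
    simp_all
  · intro i _ _ t ht hP f hf _
    have hf' : ∀ k, |gridPt n s k - i.val| ≤ t + 2 * Δ →
        orRule.step^[Δ] f (gridPt n s k : ℤ) = e₁ (gridPt n s k : ℤ) := by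
      intro k hk
      simpa using (hf k hk 0 (by simp)).1
    have hfg : orRule.step^[t] f i = true → orRule.step^[t] g i = true := by
      intro h
      rw [iterate_step_orRule] at h ⊢
      obtain ⟨d, hd, h⟩ := h
      refine ⟨d, hd, decide_eq_true fun k d' hd' hk => ?_⟩
      have hdvd : ((i.val + d - d' - gridPt n s k : ℤ) : ZMod n) = 0 := by
        push_cast
        rw [ZMod.natCast_zmod_val, hk]
        abel
      rw [ZMod.intCast_zmod_eq_zero_iff_dvd] at hdvd
      obtain ⟨l, hl⟩ := hdvd
      have hk' : gridPt n s (k + (n / s : ℕ) * l) = i.val + d - d' := by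
        rw [gridPt_add_mul n s hs0 hsn]; linarith
      have hcast : ((gridPt n s (k + (n / s : ℕ) * l) : ℤ) : ZMod n) = gridPt n s k := by
        rw [gridPt_add_mul n s hs0 hsn]; simp
      rw [← hcast, ← hf' _ (by rw [hk']; rw [abs_le] at *; omega), iterate_step_orRule]
      refine ⟨d', hd', ?_⟩
      rw [hcast, ← hk, h]
    cases hgt : orRule.step^[t] g i with
    | false =>
      by_contra hne
      rw [Bool.not_eq_false] at hne
      simp_all
    | true =>
      -- Away from the transition, `g` has a 1 already within `t - 2 * Δ`. A grid point within `2 *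
      -- s` of it is 1 at time `Δ`, so `f` has a 1 at most `2 * s + Δ ≤ 2 * Δ` away from it, hence
      -- within `t` of `i`.
      have h1 : ¬ orRule.step^[t - 2 * Δ] g i = false := by
        intro h
        have h2 := hP h
        have h3 := hmono i t (t + 2 * Δ) (by omega) hgt
        simp_all
      rw [Bool.not_eq_false, iterate_step_orRule] at h1
      obtain ⟨d, hd, h⟩ := h1
      have h2 := hgrid.idx_le (i.val + d)
      have h3 := hgrid.lt_idx (i.val + d)
      have h4 := hgrid.gap_le (gridIdx n s (i.val + d))
      generalize gridIdx n s (i.val + d) = k at *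
      have h5 : e₁ (gridPt n s k : ℤ) = true := by
        refine of_decide_eq_true h k (i.val + d - gridPt n s k) ?_ ?_
        · rw [abs_le]; omega
        · push_cast
          rw [ZMod.natCast_zmod_val]
          abel
      rw [← hf' k (by rw [abs_le] at *; omega), iterate_step_orRule] at h5
      obtain ⟨d', hd', h6⟩ := h5
      rw [iterate_step_orRule]
      refine ⟨gridPt n s k + d' - i.val, by rw [abs_le] at *; omega, ?_⟩
      rw [← h6]
      congr 1
      push_cast
      rw [ZMod.natCast_zmod_val]
      abel

/-! ### Majority dynamics on the integers -/

/-- The majority rule. -/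
def majRule : LocalRule := fun a b c => (a && b) || (a && c) || (b && c)

/-- The value of `f` at `j` differs from the values at both neighbours of `j`. -/
def Unstable (f : ℤ → Bool) (j : ℤ) : Prop :=
  f (j - 1) = !f j ∧ f (j + 1) = !f j

theorem Unstable.congr {f g : ℤ → Bool} {j : ℤ} (h1 : f (j - 1) = g (j - 1)) (h2 : f j = g j)
    (h3 : f (j + 1) = g (j + 1)) : Unstable f j ↔ Unstable g j := by
  rw [Unstable, Unstable, h1, h2, h3]

theorem Unstable.step_majRule {f : ℤ → Bool} {j : ℤ} (h : Unstable f j) :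
    majRule.step f j = !f j := by
  simp [LocalRule.step, majRule, h.1, h.2]

theorem step_majRule_of_not_unstable {f : ℤ → Bool} {j : ℤ} (h : ¬ Unstable f j) :
    majRule.step f j = f j := by
  unfold Unstable at h
  simp only [LocalRule.step, majRule]
  cases h1 : f (j - 1) <;> cases h2 : f j <;> cases h3 : f (j + 1) <;> simp_all

theorem unstable_step_majRule_iff {f : ℤ → Bool} {j : ℤ} :
    Unstable (majRule.step f) j ↔ Unstable f (j - 1) ∧ Unstable f j ∧ Unstable f (j + 1) := by
  simp only [Unstable, LocalRule.step, majRule, sub_add_cancel, add_sub_cancel_right]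
  cases f (j - 1 - 1) <;> cases f (j - 1) <;> cases f j <;> cases f (j + 1) <;>
    cases f (j + 1 + 1) <;> simp

theorem unstable_iterate_majRule_iff {f : ℤ → Bool} {t : ℕ} {i : ℤ} :
    Unstable (majRule.step^[t] f) i ↔ ∀ j, |j - i| ≤ t → Unstable f j := by
  induction t generalizing i with
  | zero =>
    simp only [Function.iterate_zero, id_eq, Nat.cast_zero]
    refine ⟨fun h j hj => ?_, fun h => h i (by simp)⟩
    have : j = i := by rw [abs_le] at hj; omega
    rwa [this]
  | succ t ih =>
    rw [Function.iterate_succ_apply', unstable_step_majRule_iff, ih, ih, ih]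
    push_cast
    constructor
    · rintro ⟨h1, h2, h3⟩ j hj
      rw [abs_le] at hj
      rcases lt_trichotomy j i with h | h | h
      · exact h1 j (by rw [abs_le]; omega)
      · exact h2 j (by rw [abs_le]; omega)
      · exact h3 j (by rw [abs_le]; omega)
    · intro h
      exact ⟨fun j hj => h j (by rw [abs_le] at *; omega),
        fun j hj => h j (by rw [abs_le] at *; omega),
        fun j hj => h j (by rw [abs_le] at *; omega)⟩

theorem iterate_majRule_of_not_unstable {f : ℤ → Bool} {i : ℤ} (h : ¬ Unstable f i) (t : ℕ) :
    majRule.step^[t] f i = f i := by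
  induction t with
  | zero => rfl
  | succ t ih =>
    rw [Function.iterate_succ_apply', step_majRule_of_not_unstable, ih]
    rw [unstable_iterate_majRule_iff]
    exact fun h' => h (h' i (by simp))

theorem iterate_majRule_of_unstable {f : ℤ → Bool} {i : ℤ} {t : ℕ}
    (h : ∀ j, |j - i| < t → Unstable f j) : majRule.step^[t] f i = (f i ^^ t.bodd) := by
  induction t with
  | zero => simp
  | succ t ih =>
    push_cast at h
    rw [Function.iterate_succ_apply', Unstable.step_majRule,
      ih fun j hj => h j (by omega), Nat.bodd_succ]
    · simp
    · exact unstable_iterate_majRule_iff.2 fun j hj => h j (by omega)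

/-- An unstable neighbour of a stable location flips to its value and becomes stable, so the stable
front moves one location towards `i` per step, carrying `f e`. -/
theorem iterate_majRule_of_nearest {f : ℤ → Bool} {i e : ℤ} {t : ℕ} (he : ¬ Unstable f e)
    (h : ∀ j, |j - i| < |e - i| → Unstable f j) (ht : |e - i| ≤ t) :
    majRule.step^[t] f i = f e := by
  induction t generalizing f e with
  | zero =>
    have : e = i := by rw [abs_le] at ht; omega
    rw [this]; rfl
  | succ t ih =>
    push_cast at ht
    rw [Function.iterate_succ_apply]
    have hstep : ∀ {j}, ¬ Unstable f j → ¬ Unstable (majRule.step f) j := fun hj h' =>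
      hj (unstable_step_majRule_iff.1 h').2.1
    rcases lt_trichotomy e i with hlt | rfl | hgt
    · have h1 : Unstable f (e + 1) := h _ (by
        rw [abs_of_neg (by omega : e - i < 0), abs_lt]; omega)
      have h2 : majRule.step f (e + 1) = f e := by
        rw [h1.step_majRule]
        have := h1.1
        rw [add_sub_cancel_right] at this
        exact this.symm
      have h3 : ¬ Unstable (majRule.step f) (e + 1) := by
        intro h'
        have := (unstable_step_majRule_iff.1 h').1
        rw [add_sub_cancel_right] at this
        exact he this
      rw [abs_of_neg (by omega : e - i < 0)] at h ht
      have habs : |e + 1 - i| = -(e + 1 - i) := abs_of_nonpos (by omega)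
      rw [ih h3 (fun j hj => ?_) (by omega), h2]
      rw [habs] at hj
      rw [abs_lt] at hj
      exact unstable_step_majRule_iff.2 ⟨h _ (by rw [abs_lt]; omega), h _ (by rw [abs_lt]; omega),
        h _ (by rw [abs_lt]; omega)⟩
    · rw [iterate_majRule_of_not_unstable (hstep he), step_majRule_of_not_unstable he]
    · have h1 : Unstable f (e - 1) := h _ (by
        rw [abs_of_pos (by omega : 0 < e - i), abs_lt]; omega)
      have h2 : majRule.step f (e - 1) = f e := by
        rw [h1.step_majRule]
        have := h1.2
        rw [sub_add_cancel] at this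
        exact this.symm
      have h3 : ¬ Unstable (majRule.step f) (e - 1) := by
        intro h'
        have := (unstable_step_majRule_iff.1 h').2.2
        rw [sub_add_cancel] at this
        exact he this
      rw [abs_of_pos (by omega : 0 < e - i)] at h ht
      have habs : |e - 1 - i| = e - 1 - i := abs_of_nonneg (by omega)
      rw [ih h3 (fun j hj => ?_) (by omega), h2]
      rw [habs] at hj
      rw [abs_lt] at hj
      exact unstable_step_majRule_iff.2 ⟨h _ (by rw [abs_lt]; omega), h _ (by rw [abs_lt]; omega),
        h _ (by rw [abs_lt]; omega)⟩

/-- The initial intervals of radius `t` around `a` and `b` are unstable throughout and together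
cover the one around `j`. -/
theorem unstable_iterate_majRule_of_between {f : ℤ → Bool} {t : ℕ} {a b j : ℤ}
    (ha : Unstable (majRule.step^[t] f) a) (hb : Unstable (majRule.step^[t] f) b) (haj : a ≤ j)
    (hjb : j ≤ b) (hab : b - a ≤ 2 * t) : Unstable (majRule.step^[t] f) j := by
  rw [unstable_iterate_majRule_iff] at *
  intro k hk
  rw [abs_le] at hk
  rcases le_or_gt k (a + t) with h | h
  · exact ha k (by rw [abs_le]; omega)
  · exact hb k (by rw [abs_le]; omega)

theorem eq_xor_bodd_of_unstable {f : ℤ → Bool} {a j : ℤ} (haj : a ≤ j)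
    (h : ∀ k, a ≤ k → k ≤ j → Unstable f k) : f j = (f a ^^ (j - a).bodd) := by
  induction j, haj using Int.leInduction with
  | base => simp
  | succ j haj ih =>
    rw [(h j haj (by omega)).2, ih fun k h1 h2 => h k h1 (by omega)]
    have : j + 1 - a = j - a + 1 := by ring
    rw [this, Int.bodd_add]
    simp

theorem iterate_majRule_comp_neg (f : ℤ → Bool) (t : ℕ) (i : ℤ) :
    majRule.step^[t] (fun j => f (-j)) i = majRule.step^[t] f (-i) := by
  induction t generalizing i with
  | zero => rfl
  | succ t ih =>
    simp only [Function.iterate_succ_apply', LocalRule.step] at ih ⊢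
    rw [ih, ih, ih]
    have h1 : -(i - 1) = -i + 1 := by ring
    have h2 : -(i + 1) = -i - 1 := by ring
    rw [h1, h2]
    generalize majRule.step^[t] f (-i - 1) = a
    generalize majRule.step^[t] f (-i) = b
    generalize majRule.step^[t] f (-i + 1) = c
    cases a <;> cases b <;> cases c <;> rfl

theorem unstable_comp_neg_iff {f : ℤ → Bool} {j : ℤ} :
    Unstable (fun j => f (-j)) j ↔ Unstable f (-j) := by
  have h1 : -(j - 1) = -j + 1 := by ring
  have h2 : -(j + 1) = -j - 1 := by ring
  simp only [Unstable, h1, h2]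
  exact and_comm

/-- Two configurations that alternate in the same way around `i` up to their right ends, which are
close to each other and have the same final value, have the same final value at `i` if their left
ends are further away. -/
theorem iterate_majRule_eq_of_right_end {K H : ℤ → Bool} {ℓ i r : ℤ} {w t : ℕ} (hir : i < r)
    (hℓ : r - i + w + 4 ≤ i - ℓ) (hK : ∀ j, ℓ ≤ j → j ≤ r → Unstable K j)
    (hH : ∀ j, ℓ < j → j < r → H j = K j) (hend : ∃ e, r < e ∧ e ≤ r + w ∧ ¬ Unstable K e)
    (h0 : H r = K r ∨ H r = majRule.step^[w] K r)
    (h1 : H (r + 1) = majRule.step^[w] K (r + 1)) (h2 : H (r + 2) = majRule.step^[w] K (r + 2))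
    (ht : r - i + w ≤ t) : majRule.step^[t] K i = majRule.step^[t] H i := by
  classical
  obtain ⟨e, hre, hew, he, hmin⟩ : ∃ e, r < e ∧ e ≤ r + w ∧ ¬ Unstable K e ∧
      ∀ j, ℓ ≤ j → j < e → Unstable K j := by
    have hex : ∃ d : ℕ, ¬ Unstable K (r + d) := by
      obtain ⟨e, h1, h2, h3⟩ := hend
      refine ⟨(e - r).toNat, ?_⟩
      rwa [Int.toNat_of_nonneg (by omega), add_sub_cancel]
    have hlt : ∀ j, ℓ ≤ j → j < r + Nat.find hex → Unstable K j := by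
      intro j hj hj'
      rcases le_or_gt j r with h | h
      · exact hK j hj h
      · by_contra hne
        have := Nat.find_min' hex (m := (j - r).toNat) (by
          rwa [Int.toNat_of_nonneg (by omega), add_sub_cancel])
        omega
    have hpos : 0 < Nat.find hex := by
      by_contra h
      have h3 := Nat.find_spec hex
      have h4 : Nat.find hex = 0 := by omega
      rw [h4] at h3
      exact h3 (hK _ (by push_cast; omega) (by simp))
    refine ⟨r + Nat.find hex, by omega, ?_, Nat.find_spec hex, hlt⟩
    obtain ⟨e, h1, h2, h3⟩ := hend
    by_contra hgt
    exact h3 (hlt e (by omega) (by omega))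
  have hKi : majRule.step^[t] K i = K e := by
    refine iterate_majRule_of_nearest he (fun j hj => ?_) ?_
    · rw [abs_of_pos (by omega : 0 < e - i), abs_lt] at hj
      exact hmin j (by omega) (by omega)
    · rw [abs_le]; omega
  -- Within `w` steps the whole stretch from `r` to `e` takes the value `K e`, so `H` has two equal
  -- values at `r + 1` and `r + 2` that stop its alternation.
  have hnear : ∀ j, r ≤ j → j ≤ e → majRule.step^[w] K j = K e := by
    intro j hj hje
    refine iterate_majRule_of_nearest he (fun k hk => ?_) ?_
    · rw [abs_of_nonneg (by omega : 0 ≤ e - j), abs_lt] at hk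
      exact hmin k (by omega) (by omega)
    · rw [abs_le]; omega
  have hc1 : H (r + 1) = K e := by rw [h1, hnear _ (by omega) (by omega)]
  have hc2 : H (r + 2) = K e := by
    rw [h2]
    rcases le_or_gt (r + 2) e with h | h
    · exact hnear _ (by omega) h
    · have her : e = r + 1 := by omega
      subst her
      have hr := (hK r (by omega) le_rfl).2
      have heq : K (r + 2) = K (r + 1) := by
        by_contra hne
        refine he ⟨?_, ?_⟩
        · rw [add_sub_cancel_right, hr, Bool.not_not]
        · rw [add_assoc, show (1 : ℤ) + 1 = 2 from rfl]
          exact Bool.eq_not_of_ne hne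
      rw [iterate_majRule_of_not_unstable, heq]
      rintro ⟨h3, -⟩
      rw [show r + 2 - 1 = r + 1 by ring, heq] at h3
      simp at h3
  have hint : ∀ j, ℓ + 2 ≤ j → j ≤ r - 2 → Unstable H j := by
    intro j h3 h4
    exact (Unstable.congr (hH _ (by omega) (by omega)) (hH _ (by omega) (by omega))
      (hH _ (by omega) (by omega))).2 (hK j (by omega) (by omega))
  have hr1 : H (r - 1) = K (r - 1) := hH _ (by omega) (by omega)
  have hr2 : H (r - 2) = K (r - 2) := hH _ (by omega) (by omega)
  have hKr : K (r - 1) = !K r := (hK r (by omega) le_rfl).1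
  have hKr' : K (r - 2) = K r := by
    have := (hK (r - 1) (by omega) (by omega)).1
    rw [show r - 1 - 1 = r - 2 by ring] at this
    rw [this, hKr, Bool.not_not]
  have hr0 : H r = K r ∨ H r = K e := by
    rw [← hnear r le_rfl (by omega)]; exact h0
  -- The first stable location of `H` depends on parity: `r` if `K r = K e`; otherwise `r + 1` if `H
  -- r` still has the alternating value `K r`, and `r - 1` if it has the final value `K e`. In each
  -- case `H` has the value `K e` there.
  suffices ∃ e', r - 1 ≤ e' ∧ e' ≤ r + 1 ∧ H e' = K e ∧ ¬ Unstable H e' ∧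
      ∀ j, r - 1 ≤ j → j < e' → Unstable H j by
    obtain ⟨e', h3, h4, h5, h6, h7⟩ := this
    rw [hKi, ← h5]
    symm
    rcases lt_or_ge e' i with hlt | hge
    · omega
    refine iterate_majRule_of_nearest h6 (fun j hj => ?_) ?_
    · rw [abs_of_nonneg (by omega : 0 ≤ e' - i), abs_lt] at hj
      rcases le_or_gt j (r - 2) with h | h
      · exact hint j (by omega) h
      · exact h7 j (by omega) (by omega)
    · have hw : 0 < (w : ℤ) := by omega
      rw [abs_le]; omega
  have hun1 : H r = !H (r - 1) → Unstable H (r - 1) := by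
    intro h
    refine ⟨?_, ?_⟩
    · rw [show r - 1 - 1 = r - 2 by ring, hr2, hr1, hKr', hKr, Bool.not_not]
    · rwa [sub_add_cancel]
  rcases Bool.eq_or_eq_not (K r) (K e) with heq | hne
  · refine ⟨r, by omega, by omega, ?_, ?_, fun j h3 h4 => ?_⟩
    · rcases hr0 with h | h
      · rw [h, heq]
      · exact h
    · rintro ⟨-, h⟩
      rw [hc1] at h
      rcases hr0 with h' | h' <;> rw [h'] at h <;> simp [heq] at h
    · have : j = r - 1 := by omega
      rw [this]
      apply hun1
      rw [hr1, hKr, Bool.not_not]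
      rcases hr0 with h' | h'
      · exact h'
      · rw [h', heq]
  · rcases hr0 with h | h
    · refine ⟨r + 1, by omega, le_rfl, hc1, ?_, fun j h3 h4 => ?_⟩
      · rintro ⟨-, h'⟩
        rw [add_assoc, show (1 : ℤ) + 1 = 2 from rfl, hc1, hc2] at h'
        simp at h'
      · have hor : j = r - 1 ∨ j = r := by omega
        rcases hor with rfl | rfl
        · apply hun1
          rw [hr1, hKr, Bool.not_not, h]
        · refine ⟨?_, ?_⟩
          · rw [hr1, hKr, h]
          · rw [hc1, h, hne, Bool.not_not]
    · refine ⟨r - 1, le_rfl, by omega, ?_, ?_, fun j h3 h4 => by omega⟩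
      · rw [hr1, hKr, hne, Bool.not_not]
      · rintro ⟨-, h'⟩
        rw [sub_add_cancel, h, hr1, hKr, hne] at h'
        simp at h'

theorem iterate_majRule_eq_of_left_end {K H : ℤ → Bool} {ℓ i r : ℤ} {w t : ℕ} (hir : ℓ < i)
    (hr : i - ℓ + w + 4 ≤ r - i) (hK : ∀ j, ℓ ≤ j → j ≤ r → Unstable K j)
    (hH : ∀ j, ℓ < j → j < r → H j = K j) (hend : ∃ e, ℓ - w ≤ e ∧ e < ℓ ∧ ¬ Unstable K e)
    (h0 : H ℓ = K ℓ ∨ H ℓ = majRule.step^[w] K ℓ)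
    (h1 : H (ℓ - 1) = majRule.step^[w] K (ℓ - 1)) (h2 : H (ℓ - 2) = majRule.step^[w] K (ℓ - 2))
    (ht : i - ℓ + w ≤ t) : majRule.step^[t] K i = majRule.step^[t] H i := by
  have := iterate_majRule_eq_of_right_end (K := fun j => K (-j)) (H := fun j => H (-j)) (ℓ := -r)
    (i := -i) (r := -ℓ) (w := w) (t := t) (by omega) (by omega)
    (fun j h3 h4 => unstable_comp_neg_iff.2 (hK _ (by omega) (by omega)))
    (fun j h3 h4 => hH _ (by omega) (by omega))
    (by
      obtain ⟨e, h3, h4, h5⟩ := hend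
      refine ⟨-e, by omega, by omega, ?_⟩
      rwa [unstable_comp_neg_iff, neg_neg])
    (by rwa [iterate_majRule_comp_neg, neg_neg])
    (by
      rw [iterate_majRule_comp_neg, show -(-ℓ + 1) = ℓ - 1 by ring]
      exact h1)
    (by
      rw [iterate_majRule_comp_neg, show -(-ℓ + 2) = ℓ - 2 by ring]
      exact h2)
    (by omega)
  rwa [iterate_majRule_comp_neg, iterate_majRule_comp_neg, neg_neg] at this

/-! ### Predicting majority from grid values -/

/-- Both end points of the gap with index `k` are unstable. -/
def UnstableGap (z : ℤ → ℤ) (e : ℤ → Bool) (k : ℤ) : Prop :=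
  Unstable e (z k) ∧ Unstable e (z (k + 1))

open Classical in
/-- A configuration that alternates in the gaps whose end points are unstable in `e₁`, and agrees
with `e₂` in the others. -/
noncomputable def cleanedConfig (z κ : ℤ → ℤ) (e₁ e₂ : ℤ → Bool) (j : ℤ) : Bool :=
  if UnstableGap z e₁ (κ j) then e₁ (z (κ j)) ^^ (j - z (κ j)).bodd else e₂ j

/-- The location `i` is close to the middle of a maximal sequence of unstable gaps, which is not
immediately followed by another unstable gap. -/
def NearMiddle (s Δ : ℕ) (z κ : ℤ → ℤ) (e : ℤ → Bool) (i : ℤ) : Prop :=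
  ∃ ℓ r, ℓ ≤ i ∧ i < r ∧ (∀ j, ℓ ≤ j → j < r → UnstableGap z e (κ j)) ∧
    ¬ UnstableGap z e (κ (ℓ - 1)) ∧ ¬ UnstableGap z e (κ r) ∧ |2 * i - ℓ - r| ≤ 2 * s + 10 ∧
    ∀ j, r < j → j < r + Δ → ¬ UnstableGap z e (κ j)

/-- Middles of the same stretch are within `2 * s + 10 ≤ 3 * s`. The separation clause of
`NearMiddle` puts any later stretch at least `Δ` beyond `r`. -/
theorem NearMiddle.sparse {s Δ : ℕ} (hs : 10 ≤ s) {z κ : ℤ → ℤ} {e : ℤ → Bool} {i i' : ℤ}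
    (hi : NearMiddle s Δ z κ e i) (hi' : NearMiddle s Δ z κ e i') (hii' : i ≤ i') :
    i' ≤ i + 3 * s ∨ i + Δ ≤ i' := by
  obtain ⟨ℓ, r, h1, h2, h3, h4, h5, h6, h7⟩ := hi
  obtain ⟨ℓ', r', h1', h2', h3', h4', h5', h6', -⟩ := hi'
  rcases lt_or_ge i' r with h | h
  · left
    have hr : r ≤ r' := by
      by_contra hlt
      exact h5' (h3 _ (by omega) (by omega))
    have hr' : r' ≤ r := by
      by_contra hlt
      exact h5 (h3' _ (by omega) (by omega))
    have hℓ : ℓ ≤ ℓ' := by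
      by_contra hlt
      exact h4 (h3' _ (by omega) (by omega))
    have hℓ' : ℓ' ≤ ℓ := by
      by_contra hlt
      exact h4' (h3 _ (by omega) (by omega))
    rw [abs_le] at h6 h6'
    omega
  · right
    have hne : i' ≠ r := by
      rintro rfl
      exact h5 (h3' _ h1' h2')
    by_contra hlt
    exact h7 i' (by omega) (by omega) (h3' _ h1' h2')

section

variable {s Δ : ℕ} {z κ : ℤ → ℤ} {e₁ e₂ F : ℤ → Bool} {i R : ℤ}

theorem unstable_grid_iff {K : ℤ → Bool}
    (hgr : ∀ k, |z k - i| ≤ R → ∀ d : ℤ, |d| ≤ 3 → K (z k + d) = e₁ (z k + d)) {k : ℤ}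
    (hk : |z k - i| ≤ R) : Unstable e₁ (z k) ↔ Unstable K (z k) := by
  have h := hgr k hk
  have h0 := h 0 (by simp)
  rw [add_zero] at h0
  exact Unstable.congr (h (-1) (by simp)).symm h0.symm (h 1 (by simp)).symm

/-- A gap is shorter than `2 * Δ`, so unstable end points force it to alternate throughout, and its
values follow by parity from its left end point. -/
theorem unstable_of_unstableGap (hg : IsGrid s z κ) (hsΔ : s ≤ Δ)
    (hgr : ∀ k, |z k - i| ≤ R → ∀ d : ℤ, |d| ≤ 3 →
      majRule.step^[Δ] F (z k + d) = e₁ (z k + d))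
    {j : ℤ} (hj : |j - i| ≤ R - 2 * s) (hU : UnstableGap z e₁ (κ j)) :
    Unstable (majRule.step^[Δ] F) j ∧ Unstable (majRule.step^[Δ] F) (j + 1) ∧
      cleanedConfig z κ e₁ e₂ j = majRule.step^[Δ] F j := by
  have h1 := hg.idx_le j
  have h2 := hg.lt_idx j
  have h3 := hg.gap_le (κ j)
  rw [abs_le] at hj
  have hk : |z (κ j) - i| ≤ R := by rw [abs_le]; omega
  have hk' : |z (κ j + 1) - i| ≤ R := by rw [abs_le]; omega
  have ha := (unstable_grid_iff hgr hk).1 hU.1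
  have hb := (unstable_grid_iff hgr hk').1 hU.2
  have hint : ∀ l, z (κ j) ≤ l → l ≤ z (κ j + 1) → Unstable (majRule.step^[Δ] F) l :=
    fun l hl hl' => unstable_iterate_majRule_of_between ha hb hl hl' (by omega)
  refine ⟨hint j h1 (by omega), hint (j + 1) (by omega) (by omega), ?_⟩
  have h0 := hgr _ hk 0 (by simp)
  rw [add_zero] at h0
  rw [cleanedConfig, if_pos hU, ← h0]
  exact (eq_xor_bodd_of_unstable h1 fun l hl hl' => hint l hl (by omega)).symm

/-- Instability at time `Δ + 2 * s` requires instability at time `Δ` within radius `2 * s`, which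
includes both end points of the gap. -/
theorem not_unstable_of_not_unstableGap (hg : IsGrid s z κ)
    (hgr : ∀ k, |z k - i| ≤ R → ∀ d : ℤ, |d| ≤ 3 →
      majRule.step^[Δ] F (z k + d) = e₁ (z k + d))
    {j : ℤ} (hj : |j - i| ≤ R - 2 * s) (hU : ¬ UnstableGap z e₁ (κ j)) :
    ¬ Unstable (majRule.step^[Δ + 2 * s] F) j := by
  have h1 := hg.idx_le j
  have h2 := hg.lt_idx j
  have h3 := hg.gap_le (κ j)
  rw [abs_le] at hj
  rw [add_comm, Function.iterate_add_apply, unstable_iterate_majRule_iff]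
  intro h
  refine hU ⟨?_, ?_⟩
  · refine (unstable_grid_iff hgr (by rw [abs_le]; omega)).2 (h _ ?_)
    rw [abs_le]; push_cast; omega
  · refine (unstable_grid_iff hgr (by rw [abs_le]; omega)).2 (h _ ?_)
    rw [abs_le]; push_cast; omega

theorem cleanedConfig_of_not_unstableGap {j : ℤ} (hU : ¬ UnstableGap z e₁ (κ j)) :
    cleanedConfig z κ e₁ e₂ j = e₂ j := by
  rw [cleanedConfig, if_neg hU]

theorem IsGrid.pt_idx_eq (hg : IsGrid s z κ) (hs : 0 < s) {j : ℤ} (hj : κ (j - 1) ≠ κ j) :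
    z (κ j) = j := by
  have h1 := hg.idx_le j
  have h2 := hg.lt_idx j
  by_contra hne
  exact hj (hg.idx_eq (by omega) (by omega) (by omega))

/-- A sequence of unstable gaps is not immediately followed by another unstable gap. -/
theorem not_unstableGap_of_lt (hg : IsGrid s z κ) (hs : 0 < s) (hsΔ : s ≤ Δ)
    (hgr : ∀ k, |z k - i| ≤ R → ∀ d : ℤ, |d| ≤ 3 →
      majRule.step^[Δ] F (z k + d) = e₁ (z k + d))
    {r : ℤ} (hri : i ≤ r) (hr : r - i ≤ R - 2 * s - Δ) (hU : UnstableGap z e₁ (κ (r - 1)))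
    (hU' : ¬ UnstableGap z e₁ (κ r)) {j : ℤ} (hrj : r < j) (hjr : j < r + Δ) :
    ¬ UnstableGap z e₁ (κ j) := by
  intro hj
  have h1 := (unstable_of_unstableGap (e₂ := e₁) hg hsΔ hgr (by rw [abs_le]; omega) hj).1
  have h2 := (unstable_of_unstableGap (e₂ := e₁) hg hsΔ hgr (by rw [abs_le]; omega) hU).2.1
  rw [sub_add_cancel] at h2
  have h3 : z (κ r) = r := hg.pt_idx_eq hs fun h => hU' (h ▸ hU)
  have h4 := hg.le_gap (κ r)
  have h5 := hg.gap_le (κ r)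
  rcases lt_or_ge j (z (κ r + 1)) with h | h
  · exact hU' (hg.idx_eq (by omega) (by omega) h ▸ hj)
  · refine hU' ⟨?_, ?_⟩
    · rw [unstable_grid_iff hgr (by rw [abs_le]; omega), h3]
      exact h2
    · rw [unstable_grid_iff hgr (by rw [abs_le]; omega)]
      exact unstable_iterate_majRule_of_between h2 h1 (by omega) h (by omega)

/-- By time `t` stability has reached `i` from `e`, so `Δ` further steps change nothing there; hence
time `Δ` can serve as the start. -/
theorem iterate_majRule_eq_of_not_unstable {t : ℕ} {e : ℤ}
    (he : ¬ Unstable (majRule.step^[Δ] F) e) (ht : |e - i| + Δ ≤ t) :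
    majRule.step^[t] (majRule.step^[Δ] F) i = majRule.step^[t] F i := by
  rw [← Function.iterate_add_apply, add_comm, Function.iterate_add_apply]
  apply iterate_majRule_of_not_unstable
  rw [unstable_iterate_majRule_iff] at he ⊢
  refine fun h => he fun j hj => h j ?_
  rw [abs_le] at hj ⊢
  have h1 := le_abs_self (e - i)
  have h2 := neg_abs_le (e - i)
  omega

theorem iterate_majRule_eq_cleanedConfig_right (hg : IsGrid s z κ) (hs : 10 ≤ s)
    (hsΔ : 8 * s ≤ Δ) {t : ℕ}
    (hgr : ∀ k, |z k - i| ≤ t + 2 * Δ → ∀ d : ℤ, |d| ≤ 3 →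
      majRule.step^[Δ] F (z k + d) = e₁ (z k + d))
    (hgr' : ∀ k, |z k - i| ≤ t + 2 * Δ → ∀ d : ℤ, |d| ≤ 3 →
      majRule.step^[Δ + 2 * s] F (z k + d) = e₂ (z k + d))
    (hmid : ¬ NearMiddle s Δ z κ e₁ i) {δ : ℕ} (hδ : 0 < δ) (hδt : δ + 2 * Δ ≤ t)
    (hmin : ∀ j, |j - i| < δ → UnstableGap z e₁ (κ j)) (hU : ¬ UnstableGap z e₁ (κ (i + δ))) :
    majRule.step^[t] F i = majRule.step^[t] (cleanedConfig z κ e₁ e₂) i := by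
  classical
  have hs0 : 0 < s := by omega
  obtain ⟨r, hr⟩ : ∃ r, r = i + δ := ⟨_, rfl⟩
  rw [← hr] at hU
  have hU1 : UnstableGap z e₁ (κ (r - 1)) := hmin _ (by rw [abs_lt]; omega)
  have hzr : z (κ r) = r := hg.pt_idx_eq hs0 fun h => hU (h ▸ hU1)
  have hgap := hg.le_gap (κ r)
  have hgap' := hg.gap_le (κ r)
  -- Since `i` is not near the middle, the left end is further away by more than the uncertainty `2
  -- * s` in the position of the right end.
  have hleft : ∀ j, i - δ - 2 * s - 6 ≤ j → j < r → UnstableGap z e₁ (κ j) := by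
    by_contra hne
    push Not at hne
    obtain ⟨j, hj1, hj2, hj3⟩ := hne
    have hji : j ≤ i - δ := by
      by_contra hlt
      exact hj3 (hmin j (by rw [abs_lt]; omega))
    have hex : ∃ d : ℕ, ¬ UnstableGap z e₁ (κ (i - d)) := by
      refine ⟨(i - j).toNat, ?_⟩
      rwa [Int.toNat_of_nonneg (by omega), sub_sub_cancel]
    have hd1 : δ ≤ Nat.find hex := by
      by_contra hlt
      exact Nat.find_spec hex (hmin _ (by rw [abs_lt]; omega))
    have hd2 : (Nat.find hex : ℤ) ≤ δ + 2 * s + 6 := by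
      have := Nat.find_min' hex (m := (i - j).toNat) (by
        rwa [Int.toNat_of_nonneg (by omega), sub_sub_cancel])
      omega
    refine hmid ⟨i - Nat.find hex + 1, r, by omega, by omega, fun l hl hl' => ?_, ?_, hU, ?_,
      fun l hl hl' => not_unstableGap_of_lt hg hs0 (by omega) hgr (by omega) (by omega)
        hU1 hU hl hl'⟩
    · rcases le_or_gt l i with h | h
      · by_contra hne
        have := Nat.find_min' hex (m := (i - l).toNat) (by
          rwa [Int.toNat_of_nonneg (by omega), sub_sub_cancel])
        omega
      · exact hmin l (by rw [abs_lt]; omega)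
    · rw [add_sub_cancel_right]
      exact Nat.find_spec hex
    · rw [abs_le]; omega
  have hun : ∀ j, i - δ - 2 * s - 6 ≤ j → j < r →
      Unstable (majRule.step^[Δ] F) j ∧ Unstable (majRule.step^[Δ] F) (j + 1) ∧
      cleanedConfig z κ e₁ e₂ j = majRule.step^[Δ] F j := fun j hj hj' =>
    unstable_of_unstableGap hg (by omega) hgr (by rw [abs_le]; omega) (hleft j hj hj')
  have hr' := (hun (r - 1) (by omega) (by omega)).2.1
  rw [sub_add_cancel] at hr'
  have hend : ¬ Unstable (majRule.step^[Δ] F) (z (κ r + 1)) := by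
    rw [← unstable_grid_iff hgr (by rw [abs_le]; omega)]
    refine fun h => hU ⟨?_, h⟩
    rw [unstable_grid_iff hgr (by rw [abs_le]; omega), hzr]
    exact hr'
  have hH : ∀ d : ℤ, 0 ≤ d → d ≤ 2 → cleanedConfig z κ e₁ e₂ (r + d) =
      majRule.step^[2 * s] (majRule.step^[Δ] F) (r + d) := by
    intro d h0 h2
    have hκ : κ (r + d) = κ r := hg.idx_eq (by omega) (by omega) (by omega)
    rw [cleanedConfig_of_not_unstableGap (by rwa [hκ]), ← Function.iterate_add_apply,
      add_comm (2 * s),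
      ← hzr, hgr' (κ r) (by rw [abs_le]; omega) d (by rw [abs_le]; omega)]
  rw [← iterate_majRule_eq_of_not_unstable hend (by
    rw [abs_of_nonneg (by omega : 0 ≤ z (κ r + 1) - i)]; omega)]
  refine iterate_majRule_eq_of_right_end (ℓ := i - δ - 2 * s - 6) (r := r) (w := 2 * s)
    (by omega) (by push_cast; omega) (fun j hj hj' => ?_) (fun j hj hj' => ?_)
    ⟨_, by omega, by push_cast; omega, hend⟩ (Or.inr ?_) (hH 1 (by norm_num) (by norm_num))
    (hH 2 (by norm_num) (by norm_num)) (by push_cast; omega)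
  · rcases lt_or_eq_of_le hj' with h | h
    · exact (hun j hj h).1
    · rw [h]; exact hr'
  · exact (hun j hj.le hj').2.2
  · simpa using hH 0 le_rfl (by norm_num)

theorem iterate_majRule_eq_cleanedConfig_left (hg : IsGrid s z κ) (hs : 10 ≤ s)
    (hsΔ : 8 * s ≤ Δ) {t : ℕ}
    (hgr : ∀ k, |z k - i| ≤ t + 2 * Δ → ∀ d : ℤ, |d| ≤ 3 →
      majRule.step^[Δ] F (z k + d) = e₁ (z k + d))
    (hgr' : ∀ k, |z k - i| ≤ t + 2 * Δ → ∀ d : ℤ, |d| ≤ 3 →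
      majRule.step^[Δ + 2 * s] F (z k + d) = e₂ (z k + d))
    (hmid : ¬ NearMiddle s Δ z κ e₁ i) {δ : ℕ} (hδ : 1 < δ) (hδt : δ + 2 * Δ ≤ t)
    (hmin : ∀ j, |j - i| < δ → UnstableGap z e₁ (κ j)) (hU : ¬ UnstableGap z e₁ (κ (i - δ))) :
    majRule.step^[t] F i = majRule.step^[t] (cleanedConfig z κ e₁ e₂) i := by
  classical
  have hs0 : 0 < s := by omega
  -- Gaps are half-open, so the boundary grid point belongs here to the unstable gap and keeps its
  -- alternating value; at a right end it belongs to the stable gap and has its value from `e₂`.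
  obtain ⟨ℓ, hℓ⟩ : ∃ ℓ, ℓ = i - δ + 1 := ⟨_, rfl⟩
  rw [show i - δ = ℓ - 1 by omega] at hU
  have hU1 : UnstableGap z e₁ (κ ℓ) := hmin _ (by rw [abs_lt]; omega)
  have hzℓ : z (κ ℓ) = ℓ := hg.pt_idx_eq hs0 fun h => hU (h.symm ▸ hU1)
  have hgap := hg.le_gap (κ ℓ - 1)
  have hgap' := hg.gap_le (κ ℓ - 1)
  rw [sub_add_cancel, hzℓ] at hgap hgap'
  have hκ : ∀ d : ℤ, 1 ≤ d → d ≤ 2 → κ (ℓ - d) = κ ℓ - 1 := fun d h1 h2 =>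
    hg.idx_eq (by omega) (by omega) (by rw [sub_add_cancel]; omega)
  have hright : ∀ j, ℓ ≤ j → j ≤ i + δ + 2 * s + 6 → UnstableGap z e₁ (κ j) := by
    by_contra hne
    push Not at hne
    obtain ⟨j, hj1, hj2, hj3⟩ := hne
    have hji : i + δ ≤ j := by
      by_contra hlt
      exact hj3 (hmin j (by rw [abs_lt]; omega))
    have hex : ∃ d : ℕ, ¬ UnstableGap z e₁ (κ (i + d)) := by
      refine ⟨(j - i).toNat, ?_⟩
      rwa [Int.toNat_of_nonneg (by omega), add_sub_cancel]
    have hd1 : δ ≤ Nat.find hex := by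
      by_contra hlt
      exact Nat.find_spec hex (hmin _ (by rw [abs_lt]; omega))
    have hd2 : (Nat.find hex : ℤ) ≤ δ + 2 * s + 6 := by
      have := Nat.find_min' hex (m := (j - i).toNat) (by
        rwa [Int.toNat_of_nonneg (by omega), add_sub_cancel])
      omega
    have hrun : ∀ l, ℓ ≤ l → l < i + Nat.find hex → UnstableGap z e₁ (κ l) := by
      intro l hl hl'
      rcases le_or_gt i l with h | h
      · by_contra hne
        have := Nat.find_min' hex (m := (l - i).toNat) (by
          rwa [Int.toNat_of_nonneg (by omega), add_sub_cancel])
        omega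
      · exact hmin l (by rw [abs_lt]; omega)
    exact hmid ⟨ℓ, i + Nat.find hex, by omega, by omega, hrun, hU, Nat.find_spec hex,
      by rw [abs_le]; omega,
      fun l hl hl' => not_unstableGap_of_lt hg hs0 (by omega) hgr (by omega) (by omega)
        (hrun _ (by omega) (by omega)) (Nat.find_spec hex) hl hl'⟩
  have hun : ∀ j, ℓ ≤ j → j ≤ i + δ + 2 * s + 6 → Unstable (majRule.step^[Δ] F) j ∧
      Unstable (majRule.step^[Δ] F) (j + 1) ∧
      cleanedConfig z κ e₁ e₂ j = majRule.step^[Δ] F j := fun j hj hj' =>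
    unstable_of_unstableGap hg (by omega) hgr (by rw [abs_le]; omega) (hright j hj hj')
  have hend : ¬ Unstable (majRule.step^[Δ] F) (z (κ ℓ - 1)) := by
    rw [← unstable_grid_iff hgr (by rw [abs_le]; omega)]
    refine fun h => hU ?_
    rw [hκ 1 le_rfl (by norm_num)]
    refine ⟨h, ?_⟩
    rw [sub_add_cancel, unstable_grid_iff hgr (by rw [abs_le]; omega), hzℓ]
    exact (hun ℓ le_rfl (by omega)).1
  have hH : ∀ d : ℤ, 1 ≤ d → d ≤ 2 → cleanedConfig z κ e₁ e₂ (ℓ - d) =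
      majRule.step^[2 * s] (majRule.step^[Δ] F) (ℓ - d) := by
    intro d h1 h2
    have hd := hgr' (κ ℓ) (by rw [abs_le]; omega) (-d) (by rw [abs_le]; omega)
    rw [hzℓ, ← sub_eq_add_neg] at hd
    rw [cleanedConfig_of_not_unstableGap, ← Function.iterate_add_apply, add_comm, hd]
    rwa [hκ d h1 h2, ← hκ 1 le_rfl (by norm_num)]
  rw [← iterate_majRule_eq_of_not_unstable hend (by
    rw [abs_of_nonpos (by omega : z (κ ℓ - 1) - i ≤ 0)]; omega)]
  exact iterate_majRule_eq_of_left_end (ℓ := ℓ) (r := i + δ + 2 * s + 6) (w := 2 * s)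
    (by omega) (by push_cast; omega) (fun j hj hj' => (hun j hj hj').1)
    (fun j hj hj' => (hun j hj.le hj'.le).2.2)
    ⟨_, by push_cast; omega, by omega, hend⟩ (Or.inl (hun ℓ le_rfl (by omega)).2.2)
    (hH 1 le_rfl (by norm_num)) (hH 2 (by norm_num) le_rfl) (by push_cast; omega)

theorem iterate_majRule_eq_cleanedConfig (hg : IsGrid s z κ) (hs : 10 ≤ s) (hsΔ : 8 * s ≤ Δ)
    (hΔ : Even Δ) {t : ℕ} (ht : 2 * Δ ≤ t) (hfar : ∀ k, 5 < |i - z k|)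
    (hgr : ∀ k, |z k - i| ≤ t + 2 * Δ → ∀ d : ℤ, |d| ≤ 3 →
      majRule.step^[Δ] F (z k + d) = e₁ (z k + d) ∧
        majRule.step^[Δ + 2 * s] F (z k + d) = e₂ (z k + d))
    (hcol : ∀ d : ℤ, |d| ≤ 3 → majRule.step^[Δ + 2 * s] F (i + d) = e₂ (i + d))
    (hmid : ¬ NearMiddle s Δ z κ e₁ i)
    (hP : (∀ j, |j - i| ≤ (t - 2 * Δ : ℕ) → UnstableGap z e₁ (κ j)) →
      ∀ j, |j - i| ≤ (t + 2 * Δ : ℕ) → UnstableGap z e₁ (κ j)) :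
    majRule.step^[t] F i = majRule.step^[t] (cleanedConfig z κ e₁ e₂) i := by
  classical
  have hs0 : 0 < s := by omega
  have hgr₁ := fun k hk d hd => (hgr k hk d hd).1
  have hgr₂ := fun k hk d hd => (hgr k hk d hd).2
  have h1 := hg.idx_le i
  have h2 := hg.lt_idx i
  have h3 := hfar (κ i)
  have h4 := hfar (κ i + 1)
  rw [abs_of_nonneg (by omega)] at h3
  rw [abs_of_nonpos (by omega)] at h4
  by_cases hU : UnstableGap z e₁ (κ i)
  · by_cases hall : ∀ j, |j - i| ≤ (t - 2 * Δ : ℕ) → UnstableGap z e₁ (κ j)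
    · have hall' := hP hall
      have hun : ∀ j, |j - i| ≤ t → Unstable (majRule.step^[Δ] F) j ∧
          Unstable (majRule.step^[Δ] F) (j + 1) ∧
          cleanedConfig z κ e₁ e₂ j = majRule.step^[Δ] F j := fun j hj =>
        unstable_of_unstableGap hg (by omega) hgr₁ (by omega) (hall' j (by push_cast; omega))
      rw [majRule.iterate_step_congr (g := majRule.step^[Δ] F) t fun d hd =>
        (hun (i + d) (by simpa using hd)).2.2, ← Function.iterate_add_apply]
      have hF : ∀ j, |j - i| ≤ (t + Δ : ℕ) → Unstable F j := by
        rw [← unstable_iterate_majRule_iff, Function.iterate_add_apply,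
          unstable_iterate_majRule_iff]
        exact fun j hj => (hun j hj).1
      rw [iterate_majRule_of_unstable fun j hj => hF j hj.le,
        iterate_majRule_of_unstable fun j hj => hF j (by push_cast; omega), Nat.bodd_add]
      -- If stability does not arrive, `i` flips at every step, so starting from time `Δ` is
      -- harmless only because `Δ` is even.
      have : Δ.bodd = false := by
        obtain ⟨q, rfl⟩ := hΔ
        simp
      simp [this]
    · push Not at hall
      obtain ⟨j, hj, hj'⟩ := hall
      have hex : ∃ δ : ℕ, ∃ j : ℤ, (j - i).natAbs = δ ∧ ¬ UnstableGap z e₁ (κ j) :=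
        ⟨_, j, rfl, hj'⟩
      have hle := Nat.find_min' hex ⟨j, rfl, hj'⟩
      have hmin : ∀ l, |l - i| < (Nat.find hex : ℕ) → UnstableGap z e₁ (κ l) := by
        intro l hl
        by_contra hne
        have := Nat.find_min' hex ⟨l, rfl, hne⟩
        rw [abs_lt] at hl
        omega
      obtain ⟨l, hl, hl'⟩ := Nat.find_spec hex
      generalize Nat.find hex = δ at *
      rw [abs_le] at hj
      have hδ : 1 < δ := by
        by_contra hlt
        have : κ l = κ i := hg.idx_eq (by omega) (by omega) (by omega)
        exact hl' (this ▸ hU)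
      have hor : l = i + δ ∨ l = i - δ := by omega
      rcases hor with rfl | rfl
      · exact iterate_majRule_eq_cleanedConfig_right hg hs hsΔ hgr₁ hgr₂ hmid (by omega)
          (by omega) hmin hl'
      · exact iterate_majRule_eq_cleanedConfig_left hg hs hsΔ hgr₁ hgr₂ hmid hδ
          (by omega) hmin hl'
  · have hst := not_unstable_of_not_unstableGap hg hgr₁ (j := i) (by simp; omega) hU
    have hH : ∀ d : ℤ, |d| ≤ 1 →
        cleanedConfig z κ e₁ e₂ (i + d) = majRule.step^[Δ + 2 * s] F (i + d) := by
      intro d hd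
      rw [hcol d (by omega), cleanedConfig_of_not_unstableGap]
      rw [abs_le] at hd
      rwa [hg.idx_eq (j := i + d) (k := κ i) (by omega) (by omega) (by omega)]
    have h0 := hH 0 (by simp)
    rw [add_zero] at h0
    have hst' : ¬ Unstable (cleanedConfig z κ e₁ e₂) i := by
      rwa [Unstable.congr (hH (-1) (by simp)) h0 (hH 1 (by simp))]
    obtain ⟨u, rfl⟩ : ∃ u, t = u + (Δ + 2 * s) := ⟨t - (Δ + 2 * s), by omega⟩
    rw [iterate_majRule_of_not_unstable hst', Function.iterate_add_apply,
      iterate_majRule_of_not_unstable hst, h0]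

end

theorem isPredictable_majRule : IsPredictable majRule := by
  classical
  refine IsPredictable.of_grid fun n s Δ _ hs hsΔ hΔ hΔn e₁ e₂ => ?_
  have hs0 : 0 < s := by omega
  have hsn : s ≤ n := by omega
  have hn : 0 < n := by omega
  have hgrid := isGrid_gridPt hs0 hsn
  have hval : ∀ i : ZMod n, ((i.val : ℤ) : ZMod n) = i := fun i => by simp
  let e₁' : ℤ → Bool := fun z => e₁ z
  let e₂' : ℤ → Bool := fun z => e₂ z
  let H : ℤ → Bool := cleanedConfig (gridPt n s) (gridIdx n s) e₁' e₂'
  -- Periodicity lets the configuration glued together on `ℤ` descend to the cycle.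
  have hH : Function.Periodic H n := by
    intro j
    have h1 : ∀ j : ℤ, e₁' (j + n) = e₁' j := fun j => by simp [e₁']
    have h2 : ∀ j : ℤ, e₂' (j + n) = e₂' j := fun j => by simp [e₂']
    have h3 : ∀ j : ℤ, Unstable e₁' (j + n) ↔ Unstable e₁' j := by
      intro j
      rw [Unstable, Unstable, add_sub_right_comm, add_right_comm, h1, h1, h1]
    have h4 : ∀ k, UnstableGap (gridPt n s) e₁' (k + (n / s : ℕ)) ↔
        UnstableGap (gridPt n s) e₁' k := by
      intro k
      rw [UnstableGap, UnstableGap, add_right_comm, gridPt_add n s hs0 hsn,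
        gridPt_add n s hs0 hsn, h3, h3]
    simp only [H, cleanedConfig]
    rw [gridIdx_add n s hn, h4, gridPt_add n s hs0 hsn, h1, h2, add_sub_add_right_eq_sub]
  let g : ZMod n → Bool := fun i => H i.val
  have hgH : (fun j : ℤ => g j) = H := by
    funext j
    simp only [g]
    rw [ZMod.val_intCast]
    have h := hH.int_mul (j / n) (j % n)
    rw [Int.cast_id, mul_comm, Int.emod_add_mul_ediv] at h
    exact h.symm
  refine ⟨g, fun i t => ∀ j, |j - (i.val : ℤ)| ≤ t →
      UnstableGap (gridPt n s) e₁' (gridIdx n s j),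
    Finset.univ.filter fun i => NearMiddle s Δ (gridPt n s) (gridIdx n s) e₁' i.val,
    fun i t t' htt' h j hj => h j (hj.trans (by exact_mod_cast htt')), ?_, ?_⟩
  · refine card_le_of_sparse (by omega) _ fun i hi j hj hij => ?_
    have := NearMiddle.sparse (by omega) (Finset.mem_filter.1 hi).2 (Finset.mem_filter.1 hj).2
      (by exact_mod_cast hij)
    exact_mod_cast this
  · intro i hi hfar t ht hP f hgr hcol
    rw [← hval i, majRule.iterate_step_intCast, majRule.iterate_step_intCast, hgH]
    refine iterate_majRule_eq_cleanedConfig hgrid (by omega) (by omega) hΔ ht hfar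
      (fun k hk d hd => ?_) (fun d hd => ?_) (fun h => hi (by simpa using h)) hP
    · rw [← majRule.iterate_step_intCast, ← majRule.iterate_step_intCast]
      exact hgr k hk d hd
    · rw [← majRule.iterate_step_intCast]
      exact (hcol d hd).2

/-! ### All threshold rules -/

theorem IsThresholdRule.isPredictable {ρ : LocalRule} (hρ : IsThresholdRule ρ) :
    IsPredictable ρ := by
  obtain ⟨b, hb, α, h⟩ := hρ
  have hval : ∀ a₁ a₂ a₃, ρ a₁ a₂ a₃ =
      (decide (b ≤ a₁.toNat + a₂.toNat + a₃.toNat) ^^ !α) := by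
    intro a₁ a₂ a₃
    have := h a₁ a₂ a₃
    by_cases hle : b ≤ a₁.toNat + a₂.toNat + a₃.toNat
    · rw [decide_eq_true hle, this.2 hle]; cases α <;> rfl
    · rw [decide_eq_false hle, Bool.eq_not_of_ne fun h' => hle (this.1 h')]; cases α <;> rfl
  interval_cases b
  · have : ρ = fun _ _ _ => α := by
      funext a₁ a₂ a₃
      exact (h a₁ a₂ a₃).2 (Nat.zero_le _)
    rw [this]
    exact isPredictable_const α
  · cases α
    · refine isPredictable_norRule.flip (fun _ => false) fun t a b c => ?_
      rw [hval]; cases a <;> cases b <;> cases c <;> rfl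
    · refine isPredictable_orRule.flip (fun _ => false) fun t a b c => ?_
      rw [hval]; cases a <;> cases b <;> cases c <;> rfl
  · cases α
    -- Minority becomes majority when the values at odd times are complemented.
    · refine isPredictable_majRule.flip Nat.bodd fun t a b c => ?_
      rw [hval, Nat.bodd_succ]; cases a <;> cases b <;> cases c <;> cases t.bodd <;> rfl
    · refine isPredictable_majRule.flip (fun _ => false) fun t a b c => ?_
      rw [hval]; cases a <;> cases b <;> cases c <;> rfl
  · cases α
    · refine isPredictable_norRule.flip (fun _ => true) fun t a b c => ?_
      rw [hval]; cases a <;> cases b <;> cases c <;> rfl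
    · refine isPredictable_orRule.flip (fun _ => true) fun t a b c => ?_
      rw [hval]; cases a <;> cases b <;> cases c <;> rfl

theorem theorem2 (ρ : LocalRule) (hρ : IsThresholdRule ρ) :
    ∃ (C : ℝ) (T : (m n : ℕ) → (ε : ℝ) → RandomizedNonadaptiveAlgorithm m n),
      ∀ (m n : ℕ) [NeZero n] (ε : ℝ), 0 < ε → ε < 1 →
        RandomizedNonadaptiveAlgorithm.IsOneSidedTester (T m n ε) ρ ε ∧
        RandomizedNonadaptiveAlgorithm.QueryComplexityLE (T m n ε) (C / ε ^ 4) :=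
  hρ.isPredictable.exists_tester
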